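/- Let $c_{ww}(\kappa)=\sqrt{\tanh\kappa/\kappa}$ for $\kappa\neq0$, $c_{ww}(0)=1$, and let $c_{ww}^2(\kappa|\partial_z|)$ be the Fourier multiplier on $2\pi$-periodic functions with $c_{ww}^2(\kappa|\partial_z|)e^{inz}=c_{ww}^2(n\kappa)e^{inz}$ for $n\in\mathbb Z$. Consider, for $\kappa>0$, $b_1,b_2\in\mathbb R$ and $c>0$, the periodic traveling-wave system $$-c\eta+u+u\eta=(1-c^2)b_1,\qquad -cu+c_{ww}^2(\kappa|\partial_z|)\eta+\tfrac12u^2=(1-c^2)b_2 .$$ **Theorem 2.1 (Existence of sufficiently small, periodic wave trains).** For every $\kappa>0$ and all $b_1,b_2\in\mathbb R$ with $|b_1|,|b_2|$ sufficiently small, there is a one-parameter family of real solutions $\eta(a;\kappa,b_1,b_2)(z)$, $u(a;\kappa,b_1,b_2)(z)$, $c(a;\kappa,b_1,b_2)>0$ of this system, for $a\in\mathbb R$ with $|a|$ sufficiently small (how small may depend on $\kappa$). More precisely, $\eta,u,c$ are defined for $(a,\kappa,b_1,b_2)$ in an open set $U\subset\mathbb R\times(0,\infty)\times\mathbb R^2$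 that contains $(0,\kappa,0,0)$ for every $\kappa>0$ and is invariant under $a\mapsto-a$. The functions $\eta$ and $u$ are $2\pi$-periodic, even and smooth in $z$, and $c$ is even in $a$; $\eta,u,c$ depend jointly real-analytically on $(a,\kappa,b_1,b_2)\in U$, where for $\eta$ and $u$ this means that, for every $k\ge 0$, the parameters are mapped analytically to $\partial_z^k\eta$, $\partial_z^ku$ in the supremum norm. Moreover, there are real numbers $\eta_0,u_0,c_0$ depending on $(\kappa,b_1,b_2)$ such that, for each fixed $\kappa>0$ and uniformly in $z$, $$\eta=\eta_0+a\cos z+a(b_1c_{ww}(\kappa)+b_2)\cos z+a^2(h_0+h_2\cos2z)+O\big(|a|(|a|+|b_1|+|b_2|)^2\big),$$ $$u=u_0+a\,c_{ww}(\kappa)\cos z+\tfrac12a\,c_{ww}(\kappa)(b_1c_{ww}(\kappa)+b_2)\cos z+a^2c_{ww}(\kappa)\big(h_0-\tfrac12+(h_2-\tfrac12)\cos2z\big)+O\big(|a|(|a|+|b_1|+|b_2|)^2\big),$$ $$c=c_0+\tfrac34a^2c_{ww}(\kappa)(2h_0+h_2-1)+O\big(|a|(|a|+|b_1|+|b_2|)^2\big)$$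 as $a,b_1,b_2\to0$, and $$\eta_0=b_1c_{ww}(\kappa)+b_2+O\big((|b_1|+|b_2|)^2\big),\qquad u_0=b_1+b_2c_{ww}(\kappa)+O\big((|b_1|+|b_2|)^2\big),$$ $$c_0=c_{ww}(\kappa)+b_1\big(\tfrac12c_{ww}^2(\kappa)+1\big)+\tfrac32b_2c_{ww}(\kappa)+O\big((|b_1|+|b_2|)^2\big)$$ as $b_1,b_2\to0$, where $$h_0=\frac34\,\frac{c_{ww}^2(\kappa)}{c_{ww}^2(\kappa)-1},\qquad h_2=\frac34\,\frac{c_{ww}^2(\kappa)}{c_{ww}^2(\kappa)-c_{ww}^2(2\kappa)} .$$ -/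

import Mathlib

noncomputable section

namespace WaveTrain

/-- The phase speed `√(tanh κ / κ)`, extended by its limit `1` at `κ = 0`. -/
def cww (κ : ℝ) : ℝ :=
  if κ = 0 then 1 else Real.sqrt (Real.tanh κ / κ)

/-- The Fourier coefficient `(1/2π) ∫_{-π}^{π} v(z) e^{-inz} dz` of a `2π`-periodic function. -/
def fourierCoef (v : ℝ → ℝ) (n : ℤ) : ℂ :=
  (1 / (2 * Real.pi) : ℂ) *
    ∫ z in (-Real.pi)..Real.pi, (v z : ℂ) * Complex.exp (-(Complex.I * n * z))

/-- The Fourier multiplier operator `cww²(κ|∂_z|)`, determined by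
`cww²(κ|∂_z|) e^{inz} = cww²(nκ) e^{inz}`. The series converges absolutely for smooth
`2π`-periodic `v`, and its sum is then real. -/
def dispersion (κ : ℝ) (v : ℝ → ℝ) (z : ℝ) : ℂ :=
  ∑' n : ℤ, ((cww (n * κ) : ℂ) ^ 2) * fourierCoef v n * Complex.exp (Complex.I * n * z)

/-- The periodic traveling-wave system
`-cη + u + uη = (1 - c²) b₁`, `-cu + cww²(κ|∂_z|) η + u²/2 = (1 - c²) b₂`. -/
def SolvesSystem (κ b₁ b₂ c : ℝ) (η u : ℝ → ℝ) : Prop :=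
  (∀ z : ℝ, -c * η z + u z + u z * η z = (1 - c ^ 2) * b₁) ∧
  (∀ z : ℝ, -(c : ℂ) * (u z : ℂ) + dispersion κ η z + (1 / 2 : ℂ) * (u z : ℂ) ^ 2 =
    (1 - (c : ℂ) ^ 2) * (b₂ : ℂ))

/-- Real-analytic dependence of a family of smooth functions of `z` on the parameters: for every
order `k`, the parameters are mapped analytically to `∂_z^k f`, in the Banach space of bounded
continuous functions with the supremum norm. -/
def AnalyticFamilyOn (f : ℝ × ℝ × ℝ × ℝ → ℝ → ℝ) (U : Set (ℝ × ℝ × ℝ × ℝ)) : Prop :=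
  ∀ k : ℕ, ∃ F : ℝ × ℝ × ℝ × ℝ → BoundedContinuousFunction ℝ ℝ,
    AnalyticOnNhd ℝ F U ∧ ∀ p ∈ U, ∀ z : ℝ, F p z = iteratedDeriv k (f p) z

/-- The constant `h₀`. -/
def h0 (κ : ℝ) : ℝ := 3 / 4 * (cww κ ^ 2 / (cww κ ^ 2 - 1))

/-- The constant `h₂`. -/
def h2 (κ : ℝ) : ℝ := 3 / 4 * (cww κ ^ 2 / (cww κ ^ 2 - cww (2 * κ) ^ 2))

end WaveTrain

end

/-!
Small periodic waves bifurcate from the constant states, and the whole family comes from one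
application of the analytic implicit function theorem to a desingularized system.

Write `η = m + a (cos z + α)`, `u = w + a (cww κ cos z + β)` and `c = cww κ + g` with constants
`m`, `w`, `g`. Inserting this in the wave equations, splitting off the equations for the constant
state `(m, w)` and dividing the rest by `a` leaves a polynomial system `sys` in `(m, w, g, α, β)`,
completed by the normalization that the first Fourier coefficient of `η` is
`a (1 + b₁ cww κ + b₂)`. It is solved by zero when `a = b₁ = b₂ = 0`. The linearization there
(`linOp`) acts on the `n`-th Fourier modes of `(α, β)` with determinant `cww² κ - cww² (nκ)`, which
stays away from zero for `n ≠ 1` because `cww²` is strictly decreasing; for `n = 1` the unknown `g`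
and the normalization make up for the kernel. So `linOp` is an isomorphism (`linEquiv`).

The waves live in a space `Coeff` of cosine series with exponentially decaying coefficients: a
product is a bounded bilinear map there (`mul`), every `z`-derivative is a bounded map into the
bounded continuous functions (`eval`), and `cww² (κ|∂_z|)` is a bounded diagonal operator
(`dispOp`). It is analytic in `κ` because `tanh (nκ) = (1 - qⁿ) / (1 + qⁿ)` with `q = e^{-2κ}`
(`analyticAt_dispOp`). The local branches for different `κ` agree where they meet, since each is
the only solution in some ball around the common centre `0` (`exists_implicit`). Translating a wave
by half a period turns the solution for `a` into one for `-a`, so uniqueness makes `m`, `w` and `c`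
even in `a` (`exists_branch`).

For the expansions, the explicit linear approximation `firstOrder` leaves a quadratic residual,
hence is quadratically close to the branch (`branch_firstOrder`). The errors that carry a factor
`|a|` come from evenness: an analytic function even in `a` equals its value at `a = 0` plus
`l a²` up to `O(|a| (|a| + |b₁| + |b₂|)²)`, with a constant `l` that can be read off at
`b₁ = b₂ = 0` (`even_taylor`). For `m` and `w` it is zero (`constants_eq_zero`), and for the speed it
follows from the first Fourier modes of the two wave equations (`speed_second_order`).
-/

namespace WaveTrain

open Filter Topology Asymptotics
open scoped BoundedContinuousFunction ContDiff

/-! ### Absolutely convergent cosine series -/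

/-- The space `ℓ¹` of coefficient sequences. The sequence `x` stands for the even `2π`-periodic
function `∑ xₙ 2⁻ⁿ cos (n z)`; the factor `2⁻ⁿ` makes all these functions analytic in a strip, so
that every `z`-derivative is a bounded operator into the bounded continuous functions. -/
abbrev Coeff : Type := lp (fun _ : ℕ => ℝ) 1

/-- The basis sequence that stands for `2⁻ⁿ cos (n z)`. -/
noncomputable def mode (n : ℕ) : Coeff := lp.single 1 n (1 : ℝ)

section Lift

variable {E : Type*} [NormedAddCommGroup E] [NormedSpace ℝ E]

theorem norm_mode (n : ℕ) : ‖mode n‖ = 1 := by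
  simp [mode, lp.norm_single]

theorem mode_apply (n m : ℕ) : (mode n) m = if m = n then 1 else 0 := by
  simp [mode, lp.single_apply, Pi.single_apply]

theorem hasSum_mode (x : Coeff) : HasSum (fun n => x n • mode n) x := by
  have h := lp.hasSum_single (E := fun _ : ℕ => ℝ) (p := 1) (by simp) x
  convert! h using 2 with n
  rw [mode, ← lp.single_smul]; simp

theorem coeff_summable (x : Coeff) : Summable fun n => ‖x n‖ := by
  simpa using x.2.summable

theorem coeff_norm (x : Coeff) : ‖x‖ = ∑' n, ‖x n‖ := by
  rw [lp.norm_eq_tsum_rpow (by simp)]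
  simp

/-- Continuous linear maps on `Coeff` are determined by their values on the basis. -/
theorem clm_ext {F : Type*} [AddCommMonoid F] [Module ℝ F] [TopologicalSpace F] [T2Space F]
    {f g : Coeff →L[ℝ] F} (h : ∀ n, f (mode n) = g (mode n)) : f = g := by
  ext x
  have hf := (hasSum_mode x).map f f.continuous
  have hg := (hasSum_mode x).map g g.continuous
  refine hf.unique ?_
  have : (f ∘ fun n => x n • mode n) = g ∘ fun n => x n • mode n := by
    funext n
    simp only [Function.comp_apply, map_smul, h]
  rwa [this]

theorem norm_tsum_smul_le {v : ℕ → E} {C : ℝ} (hv : ∀ n, ‖v n‖ ≤ C) (x : Coeff) :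
    ‖∑' n, x n • v n‖ ≤ C * ‖x‖ := by
  rw [coeff_norm, mul_comm, ← tsum_mul_right]
  refine tsum_of_norm_bounded ((coeff_summable x).mul_right C).hasSum fun n => ?_
  rw [norm_smul]
  gcongr
  exact hv n

variable [CompleteSpace E]

theorem summable_lift {v : ℕ → E} (hv : ∃ C, ∀ n, ‖v n‖ ≤ C) (x : Coeff) :
    Summable fun n => x n • v n := by
  obtain ⟨C, hC⟩ := hv
  refine Summable.of_norm_bounded ((coeff_summable x).mul_right C) fun n => ?_
  rw [norm_smul]
  gcongr
  exact hC n

/-- The continuous linear map on `Coeff` with prescribed bounded values on the basis. -/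
noncomputable def lift (v : ℕ → E) (hv : ∃ C, ∀ n, ‖v n‖ ≤ C) : Coeff →L[ℝ] E :=
  LinearMap.mkContinuousOfExistsBound
    { toFun := fun x => ∑' n, x n • v n
      map_add' := fun x y => by
        rw [← (summable_lift hv x).tsum_add (summable_lift hv y)]
        simp [add_smul]
      map_smul' := fun c x => by
        rw [RingHom.id_apply, ← (summable_lift hv x).tsum_const_smul]
        simp [smul_smul] }
    (hv.imp fun _ hC x => norm_tsum_smul_le hC x)

theorem lift_apply (v : ℕ → E) (hv : ∃ C, ∀ n, ‖v n‖ ≤ C) (x : Coeff) :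
    lift v hv x = ∑' n, x n • v n := rfl

theorem lift_hasSum (v : ℕ → E) (hv : ∃ C, ∀ n, ‖v n‖ ≤ C) (x : Coeff) :
    HasSum (fun n => x n • v n) (lift v hv x) := (summable_lift hv x).hasSum

@[simp]
theorem lift_mode (v : ℕ → E) (hv : ∃ C, ∀ n, ‖v n‖ ≤ C) (n : ℕ) : lift v hv (mode n) = v n := by
  rw [lift_apply, tsum_eq_single n]
  · simp [mode_apply]
  · intro m hm
    simp [mode_apply, hm]

theorem norm_lift_le {v : ℕ → E} {C : ℝ} (hC : ∀ n, ‖v n‖ ≤ C) :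
    ‖lift v ⟨C, hC⟩‖ ≤ C :=
  ContinuousLinearMap.opNorm_le_bound _ ((norm_nonneg _).trans (hC 0)) (norm_tsum_smul_le hC)

end Lift

/-- The coordinate functional `x ↦ xₙ`. -/
noncomputable def coord (n : ℕ) : Coeff →L[ℝ] ℝ :=
  lift (fun m => if m = n then 1 else 0) ⟨1, fun m => by split_ifs <;> simp⟩

theorem coord_apply (n : ℕ) (x : Coeff) : coord n x = x n := by
  rw [coord, lift_apply, tsum_eq_single n]
  · simp
  · intro m hm
    simp [hm]

theorem coord_mode (n m : ℕ) : coord n (mode m) = if m = n then 1 else 0 := lift_mode _ _ _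

theorem coeff_ext {x y : Coeff} (h : ∀ n, coord n x = coord n y) : x = y := by
  apply lp.ext
  funext n
  simpa [coord_apply] using h n

/-! ### Fourier multipliers on coefficient sequences -/

/-- The diagonal operator `xₙ ↦ μₙ xₙ`. -/
noncomputable def multiplier (μ : ℕ → ℝ) (hμ : ∃ C, ∀ n, |μ n| ≤ C) : Coeff →L[ℝ] Coeff :=
  lift (fun n => μ n • mode n) (hμ.imp fun _ hC n => by simpa [norm_smul, norm_mode] using hC n)

@[simp]
theorem multiplier_mode (μ : ℕ → ℝ) (hμ : ∃ C, ∀ n, |μ n| ≤ C) (n : ℕ) :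
    multiplier μ hμ (mode n) = μ n • mode n := lift_mode _ _ _

theorem coord_multiplier (μ : ℕ → ℝ) (hμ : ∃ C, ∀ n, |μ n| ≤ C) (n : ℕ) (x : Coeff) :
    coord n (multiplier μ hμ x) = μ n * coord n x := by
  have : (coord n).comp (multiplier μ hμ) = μ n • coord n := by
    refine clm_ext fun m => ?_
    by_cases h : m = n
    · subst h; simp [coord_mode]
    · simp [coord_mode, h]
  exact DFunLike.congr_fun this x

theorem norm_multiplier_le {μ : ℕ → ℝ} {C : ℝ} (hμ : ∀ n, |μ n| ≤ C) :
    ‖multiplier μ ⟨C, hμ⟩‖ ≤ C :=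
  norm_lift_le fun n => by simpa [norm_smul, norm_mode] using hμ n

/-! ### Products of cosine series -/

/-- The product of the functions that `mode m` and `mode n` stand for, by
`cos x cos y = (cos (x + y) + cos (x - y)) / 2`. -/
noncomputable def modeMul (m n : ℕ) : Coeff :=
  (1 / 2 : ℝ) • mode (m + n) + ((1 / 2 : ℝ) * (1 / 4) ^ min m n) • mode (max m n - min m n)

theorem norm_modeMul_le (m n : ℕ) : ‖modeMul m n‖ ≤ 1 := by
  refine (norm_add_le _ _).trans ?_
  have h : ((1 : ℝ) / 4) ^ min m n ≤ 1 := pow_le_one₀ (by norm_num) (by norm_num)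
  have h0 : 0 ≤ ((1 : ℝ) / 4) ^ min m n := by positivity
  rw [norm_smul, norm_smul, norm_mode, norm_mode, Real.norm_of_nonneg (by positivity),
    Real.norm_of_nonneg (by positivity)]
  linarith

/-- Multiplication of cosine series, as a bounded bilinear map on their coefficients. -/
noncomputable def mul : Coeff →L[ℝ] Coeff →L[ℝ] Coeff :=
  lift (fun m => lift (modeMul m) ⟨1, norm_modeMul_le m⟩) ⟨1, fun m => norm_lift_le (norm_modeMul_le m)⟩

@[simp]
theorem mul_mode (m n : ℕ) : mul (mode m) (mode n) = modeMul m n := by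
  simp [mul]

/-- The coefficient sequence of `cos (n z)`. -/
noncomputable def cosMode (n : ℕ) : Coeff := (2 : ℝ) ^ n • mode n

theorem coord_cosMode (n m : ℕ) : coord n (cosMode m) = if m = n then 2 ^ n else 0 := by
  by_cases h : m = n
  · subst h; simp [cosMode, coord_mode]
  · simp [cosMode, coord_mode, h]

theorem multiplier_cosMode (μ : ℕ → ℝ) (hμ : ∃ C, ∀ n, |μ n| ≤ C) (n : ℕ) :
    multiplier μ hμ (cosMode n) = μ n • cosMode n := by
  simp [cosMode, smul_comm (μ n)]

theorem mul_cosMode (m n : ℕ) : mul (cosMode m) (cosMode n) =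
    (1 / 2 : ℝ) • cosMode (m + n) + (1 / 2 : ℝ) • cosMode (max m n - min m n) := by
  have h : (2 : ℝ) ^ m * 2 ^ n * (1 / 4) ^ min m n = 2 ^ (max m n - min m n) := by
    have h1 : (2 : ℝ) ^ m * 2 ^ n = 2 ^ (max m n - min m n) * 4 ^ min m n := by
      rw [show (4 : ℝ) = 2 ^ 2 by norm_num, ← pow_mul, ← pow_add, ← pow_add]
      congr 1
      rcases le_total m n with h | h <;> simp [h] <;> omega
    rw [h1, mul_assoc, ← mul_pow]
    norm_num
  simp only [cosMode, map_smul, _root_.smul_apply, mul_mode, modeMul, smul_add,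
    smul_smul]
  rw [← h, pow_add]
  congr 2 <;> ring

theorem mul_comm' (x y : Coeff) : mul x y = mul y x := by
  have : mul = mul.flip := by
    refine clm_ext fun m => clm_ext fun n => ?_
    simp [modeMul, add_comm m n, min_comm m n, max_comm m n]
  conv_lhs => rw [this]
  simp

/-! ### Evaluation of cosine series and of their derivatives -/

theorem exists_bound_pow_mul (k : ℕ) : ∃ C : ℝ, ∀ n : ℕ, (n : ℝ) ^ k * (1 / 2) ^ n ≤ C := by
  have h := tendsto_pow_const_mul_const_pow_of_abs_lt_one k (r := (1 / 2 : ℝ))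
    (by rw [abs_of_pos] <;> norm_num)
  obtain ⟨C, hC⟩ := h.bddAbove_range
  exact ⟨C, fun n => hC ⟨n, rfl⟩⟩

/-- The `k`-th derivative of `2⁻ⁿ cos (n z)`. -/
noncomputable def modeFun (k n : ℕ) : ℝ →ᵇ ℝ :=
  BoundedContinuousFunction.ofNormedAddCommGroup
    (fun z : ℝ => (n : ℝ) ^ k * (1 / 2) ^ n * Real.cos (n * z + k * (Real.pi / 2)))
    (by fun_prop) ((n : ℝ) ^ k * (1 / 2) ^ n) (fun z => by
      rw [norm_mul, Real.norm_of_nonneg (by positivity)]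
      exact mul_le_of_le_one_right (by positivity) (Real.abs_cos_le_one _))

theorem modeFun_apply (k n : ℕ) (z : ℝ) : modeFun k n z =
    (n : ℝ) ^ k * (1 / 2) ^ n * Real.cos (n * z + k * (Real.pi / 2)) := rfl

theorem norm_modeFun_le (k n : ℕ) : ‖modeFun k n‖ ≤ (n : ℝ) ^ k * (1 / 2) ^ n :=
  BoundedContinuousFunction.norm_ofNormedAddCommGroup_le _ (by positivity) _

theorem exists_norm_modeFun_le (k : ℕ) : ∃ C, ∀ n, ‖modeFun k n‖ ≤ C :=
  (exists_bound_pow_mul k).imp fun _ hC n => (norm_modeFun_le k n).trans (hC n)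

/-- The `k`-th derivative of the function with given coefficients. -/
noncomputable def eval (k : ℕ) : Coeff →L[ℝ] (ℝ →ᵇ ℝ) :=
  lift (modeFun k) (exists_norm_modeFun_le k)

/-- Point evaluation on bounded continuous functions, composed with `eval k`. -/
noncomputable def evalAt (k : ℕ) (z : ℝ) : Coeff →L[ℝ] ℝ :=
  (BoundedContinuousFunction.evalCLM ℝ z).comp (eval k)

theorem evalAt_apply (k : ℕ) (z : ℝ) (x : Coeff) : evalAt k z x = eval k x z := rfl

theorem eval_mode (k n : ℕ) : eval k (mode n) = modeFun k n := lift_mode _ _ _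

theorem eval_hasSum (k : ℕ) (x : Coeff) (z : ℝ) :
    HasSum (fun n => x n * modeFun k n z) (eval k x z) := by
  have := (lift_hasSum _ (exists_norm_modeFun_le k) x).map
    (BoundedContinuousFunction.evalCLM ℝ z) (BoundedContinuousFunction.evalCLM ℝ z).continuous
  exact this

theorem eval_cosMode (n : ℕ) (z : ℝ) : eval 0 (cosMode n) z = Real.cos (n * z) := by
  simp [cosMode, eval_mode, modeFun_apply]

theorem eval_mul (x y : Coeff) (z : ℝ) : eval 0 (mul x y) z = eval 0 x z * eval 0 y z := by
  have hm : ∀ m n : ℕ, evalAt 0 z (modeMul m n) = modeFun 0 m z * modeFun 0 n z := by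
    intro m n
    have hcos : Real.cos (m * z) * Real.cos (n * z) = 1 / 2 * Real.cos (((m + n : ℕ) : ℝ) * z)
        + 1 / 2 * Real.cos (((max m n - min m n : ℕ) : ℝ) * z) := by
      rcases le_total m n with h | h
      · simp only [max_eq_right h, min_eq_left h, Nat.cast_sub h, Nat.cast_add, add_mul, sub_mul,
          Real.cos_add, Real.cos_sub]
        ring
      · simp only [max_eq_left h, min_eq_right h, Nat.cast_sub h, Nat.cast_add, add_mul, sub_mul,
          Real.cos_add, Real.cos_sub]
        ring
    have hpow : (1 / 4 : ℝ) ^ min m n * (1 / 2) ^ (max m n - min m n) =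
        (1 / 2) ^ m * (1 / 2) ^ n := by
      rw [show (1 / 4 : ℝ) = (1 / 2) ^ 2 by norm_num, ← pow_mul, ← pow_add, ← pow_add]
      congr 1
      rcases le_total m n with h | h <;> simp [h] <;> omega
    have h2 : ∀ k : ℕ, modeFun 0 k z = (1 / 2) ^ k * Real.cos (k * z) := by
      simp [modeFun_apply]
    rw [modeMul, map_add, map_smul, map_smul, evalAt_apply, evalAt_apply, eval_mode, eval_mode,
      h2, h2, h2, h2, smul_eq_mul, smul_eq_mul, pow_add]
    linear_combination (1 / 2) * Real.cos (((max m n - min m n : ℕ) : ℝ) * z) * hpow -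
      (1 / 2) ^ m * (1 / 2) ^ n * hcos
  have h1 : ∀ m : ℕ, (evalAt 0 z).comp (mul (mode m)) = modeFun 0 m z • evalAt 0 z := by
    refine fun m => clm_ext fun n => ?_
    simp [hm, evalAt_apply, eval_mode]
  have h2 : (evalAt 0 z).comp (mul.flip y) = evalAt 0 z y • evalAt 0 z := by
    refine clm_ext fun m => ?_
    have := DFunLike.congr_fun (h1 m) y
    simp only [ContinuousLinearMap.comp_apply, _root_.smul_apply, smul_eq_mul] at this
    simp [this, evalAt_apply, eval_mode, mul_comm]
  have := DFunLike.congr_fun h2 x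
  simp only [ContinuousLinearMap.comp_apply, _root_.smul_apply, smul_eq_mul,
    ContinuousLinearMap.flip_apply, evalAt_apply] at this
  rw [this, mul_comm]

theorem hasDerivAt_modeFun (k n : ℕ) (z : ℝ) :
    HasDerivAt (fun z => modeFun k n z) (modeFun (k + 1) n z) z := by
  simp only [modeFun_apply]
  have h : HasDerivAt (fun y : ℝ => (n : ℝ) * y + k * (Real.pi / 2)) n z := by
    simpa using ((hasDerivAt_id z).const_mul (n : ℝ)).add_const (k * (Real.pi / 2))
  refine (h.cos.const_mul ((n : ℝ) ^ k * (1 / 2) ^ n)).congr_deriv ?_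
  have : (n : ℝ) * z + ((k + 1 : ℕ) : ℝ) * (Real.pi / 2) =
      (n * z + k * (Real.pi / 2)) + Real.pi / 2 := by push_cast; ring
  rw [this, Real.cos_add_pi_div_two]
  ring

theorem hasDerivAt_eval (k : ℕ) (x : Coeff) (z : ℝ) :
    HasDerivAt (fun z => eval k x z) (eval (k + 1) x z) z := by
  obtain ⟨C, hC⟩ := exists_norm_modeFun_le (k + 1)
  have hb : ∀ (n : ℕ) (y : ℝ), ‖x n * modeFun (k + 1) n y‖ ≤ ‖x n‖ * C := by
    intro n y
    rw [norm_mul]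
    gcongr
    exact ((modeFun (k + 1) n).norm_coe_le_norm y).trans (hC n)
  have h := hasDerivAt_tsum (𝕜 := ℝ) (g := fun n z => x n * modeFun k n z)
    (g' := fun n z => x n * modeFun (k + 1) n z) (y₀ := 0)
    ((coeff_summable x).mul_right C) (fun n y => (hasDerivAt_modeFun k n y).const_mul _) hb
    (eval_hasSum k x 0).summable z
  simpa only [(eval_hasSum _ x _).tsum_eq] using h

theorem iteratedDeriv_eval (k : ℕ) (x : Coeff) :
    iteratedDeriv k (fun z => eval 0 x z) = fun z => eval k x z := by
  induction k with
  | zero => simp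
  | succ k ih =>
    rw [iteratedDeriv_succ, ih]
    exact funext fun z => (hasDerivAt_eval k x z).deriv

theorem contDiff_eval (x : Coeff) : ContDiff ℝ ((⊤ : ℕ∞) : WithTop ℕ∞) (fun z => eval 0 x z) :=
  contDiff_of_differentiable_iteratedDeriv fun m _ => by
    rw [iteratedDeriv_eval]
    exact fun z => (hasDerivAt_eval m x z).differentiableAt

theorem even_eval (x : Coeff) : Function.Even (fun z => eval 0 x z) := by
  intro z
  simp only
  rw [← (eval_hasSum 0 x z).tsum_eq, ← (eval_hasSum 0 x (-z)).tsum_eq]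
  simp [modeFun_apply]

theorem periodic_eval (x : Coeff) : Function.Periodic (fun z => eval 0 x z) (2 * Real.pi) := by
  intro z
  simp only
  rw [← (eval_hasSum 0 x z).tsum_eq, ← (eval_hasSum 0 x (z + 2 * Real.pi)).tsum_eq]
  simp [modeFun_apply, mul_add]

/-! ### The phase speed -/

theorem tanh_div_self_nonneg (x : ℝ) : 0 ≤ Real.tanh x / x := by
  have h : ∀ x : ℝ, 0 ≤ x → 0 ≤ Real.tanh x := fun x hx => by
    rw [Real.tanh_eq_sinh_div_cosh]
    exact div_nonneg (Real.sinh_nonneg_iff.2 hx) (Real.cosh_pos x).le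
  rcases le_total 0 x with hx | hx
  · exact div_nonneg (h x hx) hx
  · have := h (-x) (by linarith)
    rw [Real.tanh_neg] at this
    exact div_nonneg_of_nonpos (by linarith) hx

theorem cww_zero : cww 0 = 1 := by simp [cww]

theorem cww_sq {x : ℝ} (hx : x ≠ 0) : cww x ^ 2 = Real.tanh x / x := by
  rw [cww, if_neg hx, Real.sq_sqrt (tanh_div_self_nonneg x)]

theorem cww_neg (x : ℝ) : cww (-x) = cww x := by
  simp [cww, Real.tanh_neg]

theorem hasDerivAt_tanh (x : ℝ) : HasDerivAt Real.tanh (1 / Real.cosh x ^ 2) x := by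
  have h := (Real.hasDerivAt_sinh x).div (Real.hasDerivAt_cosh x) (Real.cosh_pos x).ne'
  have h2 : Real.tanh = Real.sinh / Real.cosh := funext Real.tanh_eq_sinh_div_cosh
  rw [h2]
  refine h.congr_deriv ?_
  congr 1
  linear_combination Real.cosh_sq x

theorem self_lt_sinh_mul_cosh {x : ℝ} (hx : 0 < x) : x < Real.sinh x * Real.cosh x :=
  (Real.self_lt_sinh_iff.2 hx).trans_le
    (le_mul_of_one_le_right (Real.sinh_nonneg_iff.2 hx.le) (Real.one_le_cosh x))

theorem cww_sq_strictAntiOn : StrictAntiOn (fun x => cww x ^ 2) (Set.Ioi 0) := by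
  have hd : ∀ x ∈ Set.Ioi (0 : ℝ), HasDerivAt (fun x => Real.tanh x / x)
      ((1 / Real.cosh x ^ 2 * x - Real.tanh x * 1) / x ^ 2) x := fun x hx =>
    (hasDerivAt_tanh x).div (hasDerivAt_id x) (ne_of_gt hx)
  have h : StrictAntiOn (fun x => Real.tanh x / x) (Set.Ioi 0) := by
    refine strictAntiOn_of_deriv_neg (convex_Ioi 0)
      (fun x hx => (hd x hx).continuousAt.continuousWithinAt) fun x hx => ?_
    rw [interior_Ioi] at hx
    rw [(hd x hx).deriv]
    have hc := Real.cosh_pos x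
    have hx0 : 0 < x := hx
    refine div_neg_of_neg_of_pos ?_ (by positivity)
    rw [Real.tanh_eq_sinh_div_cosh, show 1 / Real.cosh x ^ 2 * x -
      Real.sinh x / Real.cosh x * 1 = (x - Real.sinh x * Real.cosh x) / Real.cosh x ^ 2 by
        field_simp]
    exact div_neg_of_neg_of_pos (sub_neg.2 (self_lt_sinh_mul_cosh hx0)) (by positivity)
  intro x hx y hy hxy
  simp only [cww_sq (ne_of_gt hx), cww_sq (ne_of_gt hy)]
  exact h hx hy hxy

theorem cww_sq_lt_one {x : ℝ} (hx : 0 < x) : cww x ^ 2 < 1 := by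
  rw [cww_sq hx.ne', div_lt_one hx, Real.tanh_eq_sinh_div_cosh, div_lt_iff₀ (Real.cosh_pos x)]
  have h : ∀ y ∈ interior (Set.Ici (0 : ℝ)), 0 < deriv
      (fun y => y * Real.cosh y - Real.sinh y) y := by
    intro y hy
    rw [interior_Ici] at hy
    have := ((hasDerivAt_id y).mul (Real.hasDerivAt_cosh y)).sub (Real.hasDerivAt_sinh y)
    rw [show (fun y => y * Real.cosh y - Real.sinh y) = id * Real.cosh - Real.sinh from rfl,
      this.deriv]
    simpa using mul_pos hy (Real.sinh_pos_iff.2 hy)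
  have := strictMonoOn_of_deriv_pos (convex_Ici 0) (by fun_prop) h
    (Set.mem_Ici.2 le_rfl) (Set.mem_Ici.2 hx.le) hx
  simpa using this

theorem cww_pos {x : ℝ} (hx : 0 < x) : 0 < cww x := by
  rw [cww, if_neg hx.ne', Real.tanh_eq_sinh_div_cosh]
  have := Real.cosh_pos x
  have := Real.sinh_pos_iff.2 hx
  positivity

theorem abs_cww_sq_le (x : ℝ) : |cww x ^ 2| ≤ 1 := by
  rw [abs_of_nonneg (sq_nonneg _)]
  rcases lt_trichotomy x 0 with h | h | h
  · rw [← cww_neg]; exact (cww_sq_lt_one (by linarith)).le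
  · simp [h, cww_zero]
  · exact (cww_sq_lt_one h).le

theorem analyticAt_cww {κ : ℝ} (hκ : 0 < κ) : AnalyticAt ℝ cww κ := by
  have hcosh : AnalyticAt ℝ Real.cosh κ := by
    rw [funext Real.cosh_eq]; fun_prop
  have hsinh : AnalyticAt ℝ Real.sinh κ := by
    rw [funext Real.sinh_eq]; fun_prop
  have h1 : AnalyticAt ℝ (fun x => Real.tanh x / x) κ := by
    simp only [Real.tanh_eq_sinh_div_cosh]
    exact (hsinh.div hcosh (Real.cosh_pos κ).ne').div analyticAt_id hκ.ne'
  have hpos : 0 < Real.tanh κ / κ := by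
    have := cww_pos hκ
    rw [← cww_sq hκ.ne']; positivity
  have h2 : AnalyticAt ℝ (fun x => Real.sqrt (Real.tanh x / x)) κ :=
    (Real.contDiffAt_sqrt (n := ⊤) hpos.ne').analyticAt.comp (f := fun x => Real.tanh x / x) h1
  refine h2.congr ?_
  filter_upwards [eventually_ne_nhds hκ.ne'] with x hx
  simp [cww, hx]

/-- The multiplier `cww²(κ|∂_z|)` on coefficient sequences. -/
noncomputable def dispOp (κ : ℝ) : Coeff →L[ℝ] Coeff :=
  multiplier (fun n => cww (n * κ) ^ 2) ⟨1, fun _ => abs_cww_sq_le _⟩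

theorem coord_dispOp (κ : ℝ) (n : ℕ) (x : Coeff) :
    coord n (dispOp κ x) = cww (n * κ) ^ 2 * coord n x := coord_multiplier _ _ _ _

theorem dispOp_cosMode (κ : ℝ) (n : ℕ) :
    dispOp κ (cosMode n) = cww (n * κ) ^ 2 • cosMode n := multiplier_cosMode _ _ _

/-! ### The Fourier multiplier on cosine series -/

/-- The Fourier coefficient as a continuous linear functional. -/
theorem exists_fourierCoef_clm (n : ℤ) :
    ∃ L : (ℝ →ᵇ ℝ) →L[ℝ] ℂ, ∀ f : ℝ →ᵇ ℝ, L f = fourierCoef f n := by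
  have hi : ∀ f : ℝ →ᵇ ℝ, IntervalIntegrable
      (fun z : ℝ => ((f z : ℝ) : ℂ) * Complex.exp (-(Complex.I * n * z)))
      MeasureTheory.volume (-Real.pi) Real.pi := fun f =>
    Continuous.intervalIntegrable (by have := f.continuous; fun_prop) _ _
  let l : (ℝ →ᵇ ℝ) →ₗ[ℝ] ℂ :=
    { toFun := fun f => fourierCoef f n
      map_add' := fun f g => by
        simp only [fourierCoef]
        rw [← mul_add, ← intervalIntegral.integral_add (hi f) (hi g)]
        simp [add_mul]
      map_smul' := fun c f => by
        simp only [fourierCoef, RingHom.id_apply, Complex.real_smul]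
        rw [mul_left_comm, ← intervalIntegral.integral_const_mul]
        simp [mul_assoc] }
  refine ⟨l.mkContinuousOfExistsBound
    ⟨‖(1 / (2 * Real.pi) : ℂ)‖ * |Real.pi - -Real.pi|, fun f => ?_⟩, fun f => rfl⟩
  change ‖fourierCoef f n‖ ≤ _
  rw [fourierCoef, norm_mul, mul_assoc, mul_comm |_|]
  gcongr
  refine intervalIntegral.norm_integral_le_of_norm_le_const fun z _ => ?_
  rw [norm_mul, show -(Complex.I * n * z) = ((-(n * z) : ℝ) : ℂ) * Complex.I by push_cast; ring,
    Complex.norm_exp_ofReal_mul_I, mul_one, Complex.norm_real]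
  exact f.norm_coe_le_norm z

theorem integral_exp_int (k : ℤ) :
    ∫ z in (-Real.pi)..Real.pi, Complex.exp (Complex.I * k * z) =
      if k = 0 then 2 * (Real.pi : ℂ) else 0 := by
  split_ifs with h
  · subst h; simp; ring
  · rw [integral_exp_mul_complex (by simp [h])]
    have h1 : Complex.exp (Complex.I * k * (Real.pi : ℝ)) =
        Complex.exp (Complex.I * k * ((-Real.pi : ℝ) : ℂ)) := by
      rw [Complex.exp_eq_exp_iff_exists_int]
      exact ⟨k, by push_cast; ring⟩
    rw [h1]; simp

theorem fourierCoef_modeFun (m : ℕ) (n : ℤ) : fourierCoef (modeFun 0 m) n =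
    (1 / 2) ^ m * ((if n = m then 1 / 2 else 0) + (if n = -m then 1 / 2 else 0)) := by
  have h : ∀ z : ℝ, ((modeFun 0 m z : ℝ) : ℂ) * Complex.exp (-(Complex.I * n * z)) =
      (1 / 2) ^ m * (1 / 2) * Complex.exp (Complex.I * ((m - n : ℤ) : ℂ) * z) +
      (1 / 2) ^ m * (1 / 2) * Complex.exp (Complex.I * ((-m - n : ℤ) : ℂ) * z) := by
    intro z
    rw [modeFun_apply]
    push_cast
    rw [Complex.cos, show Complex.I * ((m : ℂ) - n) * z = m * z * Complex.I +
      -(Complex.I * n * z) by ring, show Complex.I * (-(m : ℂ) - n) * z = -(m * z) * Complex.I +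
      -(Complex.I * n * z) by ring, Complex.exp_add, Complex.exp_add]
    simp
    ring
  have hi : ∀ (c : ℂ) (k : ℤ), IntervalIntegrable
      (fun z : ℝ => c * Complex.exp (Complex.I * k * z))
      MeasureTheory.volume (-Real.pi) Real.pi := fun c k =>
    Continuous.intervalIntegrable (by fun_prop) _ _
  have hpi : (Real.pi : ℂ) ≠ 0 := by exact_mod_cast Real.pi_ne_zero
  rw [fourierCoef]
  simp only [h]
  rw [intervalIntegral.integral_add (hi _ _) (hi _ _), intervalIntegral.integral_const_mul,
    intervalIntegral.integral_const_mul, integral_exp_int, integral_exp_int]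
  have e1 : ((m : ℤ) - n = 0) ↔ n = m := by omega
  have e2 : (-(m : ℤ) - n = 0) ↔ n = -m := by omega
  simp only [e1, e2]
  split_ifs <;> field_simp <;> ring

theorem fourierCoef_eval (x : Coeff) (n : ℤ) : fourierCoef (eval 0 x) n =
    (if n = 0 then 1 else 1 / 2) * (1 / 2) ^ n.natAbs * (x n.natAbs : ℂ) := by
  obtain ⟨L, hL⟩ := exists_fourierCoef_clm n
  have h : L.comp (eval 0) = (((if n = 0 then 1 else 1 / 2) * (1 / 2) ^ n.natAbs : ℝ)) •
      (Complex.ofRealCLM.comp (coord n.natAbs)) := by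
    refine clm_ext fun m => ?_
    simp only [ContinuousLinearMap.comp_apply, eval_mode, hL, fourierCoef_modeFun,
      _root_.smul_apply, coord_mode, Complex.ofRealCLM_apply]
    by_cases hm : m = n.natAbs
    · subst hm
      rcases lt_trichotomy n 0 with hn | hn | hn
      · have e1 : ¬ n = n.natAbs := by omega
        have e2 : n = -n.natAbs := by omega
        simp only [if_neg e1, if_pos e2, if_neg hn.ne]
        simp
        ring
      · subst hn; simp; norm_num
      · have e1 : n = n.natAbs := by omega
        have e2 : ¬ n = -n.natAbs := by omega
        simp only [if_pos e1, if_neg e2, if_neg hn.ne']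
        simp
        ring
    · have e1 : ¬ n = m := by omega
      have e2 : ¬ n = -m := by omega
      simp [e1, e2, hm]
  have := DFunLike.congr_fun h x
  simp only [ContinuousLinearMap.comp_apply, hL, _root_.smul_apply, coord_apply,
    Complex.ofRealCLM_apply, Complex.real_smul] at this
  rw [this]
  split_ifs <;> push_cast <;> ring

/-- The series over `ℤ` is folded by pairing `n` with `-n`. -/
theorem dispersion_eval (κ : ℝ) (x : Coeff) (z : ℝ) :
    dispersion κ (eval 0 x) z = ((eval 0 (dispOp κ x) z : ℝ) : ℂ) := by
  set f : ℤ → ℂ := fun n =>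
    ((cww (n * κ) : ℂ) ^ 2) * fourierCoef (eval 0 x) n * Complex.exp (Complex.I * n * z) with hf
  have hk : ∀ n : ℕ, (cww (n * κ) : ℂ) ^ 2 * (x n : ℂ) = ((dispOp κ x) n : ℝ) := by
    intro n
    rw [← coord_apply n (dispOp κ x), coord_dispOp, coord_apply]; push_cast; ring
  have hpos : ∀ n : ℕ, f n = (if n = 0 then 1 else 1 / 2) * (1 / 2) ^ n * ((dispOp κ x) n : ℝ) *
      Complex.exp (Complex.I * n * z) := by
    intro n
    simp only [hf, fourierCoef_eval, Int.natAbs_natCast, Nat.cast_eq_zero, Int.cast_natCast]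
    rw [← hk]; ring
  have hneg : ∀ n : ℕ, f (-n) = (if n = 0 then 1 else 1 / 2) * (1 / 2) ^ n *
      ((dispOp κ x) n : ℝ) * Complex.exp (-(Complex.I * n * z)) := by
    intro n
    simp only [hf, fourierCoef_eval, Int.natAbs_neg, Int.natAbs_natCast, neg_eq_zero,
      Nat.cast_eq_zero, Int.cast_neg, Int.cast_natCast, neg_mul, cww_neg, mul_neg]
    rw [← hk]; ring
  have hb : ∀ (n : ℕ) (w : ℂ), ‖w‖ = 1 → ‖(if n = 0 then 1 else 1 / 2 : ℂ) * (1 / 2) ^ n *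
      ((dispOp κ x) n : ℝ) * w‖ ≤ ‖(dispOp κ x) n‖ := by
    intro n w hw
    rw [norm_mul, hw, mul_one, norm_mul, norm_mul, Complex.norm_real]
    have h1 : ‖(if n = 0 then 1 else 1 / 2 : ℂ)‖ ≤ 1 := by split_ifs <;> norm_num
    have h2 : ‖((1 : ℂ) / 2) ^ n‖ ≤ 1 := by
      rw [norm_pow]; exact pow_le_one₀ (norm_nonneg _) (by norm_num)
    exact mul_le_of_le_one_left (norm_nonneg _) (mul_le_one₀ h1 (norm_nonneg _) h2)
  have hs : Summable f := by
    refine Summable.of_nat_of_neg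
      (Summable.of_norm_bounded (coeff_summable (dispOp κ x)) fun n => ?_)
      (Summable.of_norm_bounded (coeff_summable (dispOp κ x)) fun n => ?_)
    · rw [hpos]
      refine hb _ _ ?_
      rw [show Complex.I * n * z = ((n * z : ℝ) : ℂ) * Complex.I by push_cast; ring,
        Complex.norm_exp_ofReal_mul_I]
    · rw [hneg]
      refine hb _ _ ?_
      rw [show -(Complex.I * n * z) = ((-(n * z) : ℝ) : ℂ) * Complex.I by push_cast; ring,
        Complex.norm_exp_ofReal_mul_I]
  have h1 : HasSum (fun n : ℕ => f n + f (-n)) (dispersion κ (eval 0 x) z + f 0) :=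
    hs.hasSum.nat_add_neg
  have h2 := (Complex.hasSum_ofReal.2 (eval_hasSum 0 (dispOp κ x) z)).add
    (hasSum_ite_eq 0 (f 0))
  have h3 : (fun n : ℕ => f n + f (-n)) = fun n : ℕ =>
      (((dispOp κ x) n * modeFun 0 n z : ℝ) : ℂ) + if n = 0 then f 0 else 0 := by
    funext n
    have hcos : Complex.exp (Complex.I * n * z) + Complex.exp (-(Complex.I * n * z)) =
        2 * Complex.cos (n * z) := by
      rw [Complex.two_cos, show Complex.I * n * z = n * z * Complex.I by ring, neg_mul]
    by_cases hn : n = 0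
    · subst hn
      have := hpos 0
      simp only [Nat.cast_zero] at this
      simp [this, modeFun_apply]
    · rw [hpos, hneg, if_neg hn, if_neg hn, modeFun_apply, ← mul_add, hcos]
      push_cast
      simp
      ring
  rw [h3] at h1
  have := h1.unique h2
  exact add_right_cancel this

/-! ### Analytic dependence of the multiplier on the wave number -/

/-- The projection onto the `n`-th mode. -/
noncomputable def modeProj (n : ℕ) : Coeff →L[ℝ] Coeff :=
  multiplier (fun m => if m = n then 1 else 0) ⟨1, fun m => by split_ifs <;> simp⟩

theorem norm_modeProj_le (n : ℕ) : ‖modeProj n‖ ≤ 1 :=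
  norm_multiplier_le fun m => by split_ifs <;> simp

/-- The power series `∑ qⁿ modeProj n` in `q` with operator coefficients. -/
noncomputable def geomSeries : FormalMultilinearSeries ℝ ℝ (Coeff →L[ℝ] Coeff) := fun n =>
  ContinuousMultilinearMap.mkPiRing ℝ (Fin n) (modeProj n)

/-- The operator `xₙ ↦ qⁿ xₙ` for `|q| < 1`, as the sum of `geomSeries`. -/
noncomputable def geomOp (q : ℝ) : Coeff →L[ℝ] Coeff := geomSeries.sum q

theorem one_le_radius_geomSeries : 1 ≤ geomSeries.radius := by
  have := geomSeries.le_radius_of_bound (r := 1) 1 fun n => by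
    simpa [geomSeries] using norm_modeProj_le n
  simpa using this

theorem analyticAt_geomOp {q : ℝ} (hq : |q| < 1) : AnalyticAt ℝ geomOp q := by
  have h := geomSeries.hasFPowerSeriesOnBall (lt_of_lt_of_le one_pos one_le_radius_geomSeries)
  refine h.analyticAt_of_mem ?_
  refine Metric.eball_subset_eball one_le_radius_geomSeries ?_
  simpa [Metric.mem_eball, edist_dist] using hq

theorem geomOp_mode {q : ℝ} (hq : |q| < 1) (n : ℕ) : geomOp q (mode n) = q ^ n • mode n := by
  have hs : HasSum (fun m => q ^ m • modeProj m) (geomOp q) := by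
    have := geomSeries.hasSum (x := q)
      (Metric.eball_subset_eball one_le_radius_geomSeries
        (by simpa [Metric.mem_eball, edist_dist] using hq))
    simpa [geomSeries, geomOp] using this
  have h2 := hs.map (ContinuousLinearMap.apply ℝ Coeff (mode n))
    (ContinuousLinearMap.apply ℝ Coeff (mode n)).continuous
  refine h2.unique ?_
  convert hasSum_single n ?_ using 1
  · simp [modeProj]
  · intro m hm
    simp [modeProj, hm.symm]

theorem tanh_eq_exp (x : ℝ) :
    Real.tanh x = (1 - Real.exp (-2 * x)) / (1 + Real.exp (-2 * x)) := by
  rw [Real.tanh_eq_sinh_div_cosh, Real.sinh_eq, Real.cosh_eq,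
    show -2 * x = -x + -x by ring, Real.exp_add, Real.exp_neg]
  have := Real.exp_pos x
  field_simp

/-- With `q = e^{-2κ}` one has `tanh (nκ) = (1 - qⁿ) / (1 + qⁿ)`, so the multiplier is a rational
expression in the analytic family `geomOp q`. -/
theorem analyticAt_dispOp {κ : ℝ} (hκ : 0 < κ) : AnalyticAt ℝ dispOp κ := by
  set N : Coeff →L[ℝ] Coeff := multiplier (fun n => (n : ℝ)⁻¹) ⟨1, fun n => by
    rw [abs_of_nonneg (by positivity)]; exact Nat.cast_inv_le_one n⟩ with hN
  set Q : ℝ → Coeff →L[ℝ] Coeff := fun κ => geomOp (Real.exp (-2 * κ)) with hQ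
  have hq : ∀ κ : ℝ, 0 < κ → |Real.exp (-2 * κ)| < 1 := fun κ h => by
    rw [abs_of_pos (Real.exp_pos _), Real.exp_lt_one_iff]; linarith
  have hmul : ∀ (S T : Coeff →L[ℝ] Coeff) (x : Coeff), (S * T) x = S (T x) := fun _ _ _ => rfl
  have hadd : ∀ (T : Coeff →L[ℝ] Coeff) (x : Coeff), (1 + T) x = x + T x := fun _ _ => rfl
  have hsub : ∀ (T : Coeff →L[ℝ] Coeff) (x : Coeff), (1 - T) x = x - T x := fun _ _ => rfl
  have hone : ∀ x : Coeff, (1 : Coeff →L[ℝ] Coeff) x = x := fun _ => rfl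
  have hunit : ∀ κ : ℝ, 0 < κ → IsUnit (1 + Q κ) := by
    intro κ h
    set q := Real.exp (-2 * κ)
    have hQm : ∀ n, Q κ (mode n) = q ^ n • mode n := geomOp_mode (hq κ h)
    set D : Coeff →L[ℝ] Coeff := multiplier (fun n => (1 + q ^ n)⁻¹) ⟨1, fun n => by
      have : 0 < q ^ n := pow_pos (Real.exp_pos _) n
      rw [abs_of_pos (by positivity)]
      exact inv_le_one_of_one_le₀ (by linarith)⟩ with hD
    have hne : ∀ n : ℕ, (1 + q ^ n) ≠ 0 := fun n => by
      have : 0 < q ^ n := pow_pos (Real.exp_pos _) n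
      positivity
    refine ⟨⟨1 + Q κ, D, ?_, ?_⟩, rfl⟩
    · refine clm_ext fun n => ?_
      simp only [hD, hmul, hadd, hone, multiplier_mode, map_smul, hQm]
      rw [smul_smul, ← add_smul]
      convert one_smul ℝ (mode n) using 2
      field_simp [hne n]
    · refine clm_ext fun n => ?_
      simp only [hD, hmul, hadd, hone, multiplier_mode, map_smul, hQm, map_add]
      rw [smul_smul, ← add_smul]
      convert one_smul ℝ (mode n) using 2
      field_simp [hne n]
  have hform : ∀ κ : ℝ, 0 < κ → dispOp κ =
      (modeProj 0 * (1 + Q κ) + κ⁻¹ • (N * (1 - Q κ))) * Ring.inverse (1 + Q κ) := by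
    intro κ h
    suffices h0 : dispOp κ * (1 + Q κ) = modeProj 0 * (1 + Q κ) + κ⁻¹ • (N * (1 - Q κ)) by
      rw [← h0, mul_assoc, Ring.mul_inverse_cancel _ (hunit κ h), mul_one]
    refine clm_ext fun n => ?_
    simp only [dispOp, hN, hQ, hmul, hadd, hsub, multiplier_mode, _root_.add_apply,
        map_smul, geomOp_mode (hq κ h), map_add, modeProj, _root_.smul_apply, map_sub]
    simp only [smul_smul, ← add_smul, ← sub_smul]
    congr 1
    by_cases hn : n = 0
    · subst hn; simp [cww_zero]
    · have hn' : (n : ℝ) * κ ≠ 0 := mul_ne_zero (by exact_mod_cast hn) h.ne'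
      rw [cww_sq hn', tanh_eq_exp, ← Real.exp_nat_mul, if_neg hn,
        show -2 * (n * κ) = n * (-2 * κ) by ring]
      have := Real.exp_pos (n * (-2 * κ))
      have hn2 : (n : ℝ) ≠ 0 := by exact_mod_cast hn
      field_simp
      ring
  have hQa : AnalyticAt ℝ Q κ :=
    (analyticAt_geomOp (hq κ hκ)).comp (f := fun κ : ℝ => Real.exp (-2 * κ)) (by fun_prop)
  have hinv : AnalyticAt ℝ (fun κ => Ring.inverse (1 + Q κ)) κ := by
    obtain ⟨u, hu⟩ := hunit κ hκ
    have := analyticAt_inverse (𝕜 := ℝ) u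
    rw [hu] at this
    exact this.comp (f := fun κ => 1 + Q κ) (analyticAt_const.add hQa)
  have h1 : AnalyticAt ℝ (fun κ => modeProj 0 * (1 + Q κ)) κ :=
    analyticAt_const.mul (analyticAt_const.add hQa)
  have h2 : AnalyticAt ℝ (fun κ : ℝ => κ⁻¹ • (N * (1 - Q κ))) κ :=
    (analyticAt_inv hκ.ne').smul (analyticAt_const.mul (analyticAt_const.sub hQa))
  have h3 : AnalyticAt ℝ (fun κ => (modeProj 0 * (1 + Q κ) + κ⁻¹ • (N * (1 - Q κ))) *
      Ring.inverse (1 + Q κ)) κ := (h1.add h2).mul hinv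
  refine (h3).congr ?_
  filter_upwards [eventually_gt_nhds hκ] with κ' h'
  exact (hform κ' h').symm

/-! ### Implicit functions along a set of base points -/

section Implicit

variable {P X Y : Type*} [NormedAddCommGroup P] [NormedSpace ℝ P] [CompleteSpace P]
  [NormedAddCommGroup X] [NormedSpace ℝ X] [CompleteSpace X]
  [NormedAddCommGroup Y] [NormedSpace ℝ Y] [CompleteSpace Y]

omit [CompleteSpace P] [CompleteSpace X] [CompleteSpace Y] in
theorem partial_fderiv {F : P × X → Y} {s : P} {L : X ≃L[ℝ] Y} (hF : DifferentiableAt ℝ F (s, 0))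
    (hL : HasFDerivAt (fun x => F (s, x)) (L : X →L[ℝ] Y) 0) :
    fderiv ℝ F (s, 0) ∘L .inr ℝ P X = L := by
  have h1 : HasFDerivAt (fun x : X => (s, x)) (.inr ℝ P X) 0 := hasFDerivAt_prodMk_right s 0
  exact (hF.hasFDerivAt.comp (0 : X) h1).unique hL

/-- The analytic implicit function theorem, with a ball around `0` on which the solution is unique.
-/
theorem exists_local_implicit {F : P × X → Y} {s : P} {L : X ≃L[ℝ] Y} {W : Set (P × X)}
    (hF : AnalyticAt ℝ F (s, 0)) (h0 : F (s, 0) = 0)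
    (hL : HasFDerivAt (fun x => F (s, x)) (L : X →L[ℝ] Y) 0) (hW : W ∈ 𝓝 (s, (0 : X))) :
    ∃ (ε r : ℝ) (φ : P → X), 0 < ε ∧ ∀ p ∈ Metric.ball s ε, AnalyticAt ℝ φ p ∧ ‖φ p‖ < r ∧
      (p, φ p) ∈ W ∧ ∀ x, ‖x‖ < r → (F (p, x) = 0 ↔ x = φ p) := by
  have hc : ContDiffAt ℝ ω F (s, 0) := hF.contDiffAt
  have hinv : (fderiv ℝ F (s, 0) ∘L .inr ℝ P X).IsInvertible :=
    ⟨L, (partial_fderiv hF.differentiableAt hL).symm⟩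
  have hω : (ω : WithTop ℕ∞) ≠ 0 := by simp
  set φ := hc.implicitFunction hω hinv with hφ
  have hφa : AnalyticAt ℝ φ s := (hc.contDiffAt_implicitFunction hω hinv).analyticAt
  have hφ0 : φ s = 0 := hc.implicitFunction_apply_self hω hinv
  have hiff := hc.eventually_apply_eq_iff_implicitFunction hω hinv
  rw [h0] at hiff
  obtain ⟨r, hr, hiff⟩ := Metric.eventually_nhds_iff_ball.1 hiff
  have hcont : Tendsto φ (𝓝 s) (𝓝 0) := by
    have := hφa.continuousAt.tendsto
    rwa [hφ0] at this
  have hpair : Tendsto (fun p => (p, φ p)) (𝓝 s) (𝓝 (s, 0)) := by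
    rw [nhds_prod_eq]
    exact tendsto_id.prodMk hcont
  have hev : ∀ᶠ p in 𝓝 s, AnalyticAt ℝ φ p ∧ ‖φ p‖ < r ∧ (p, φ p) ∈ W ∧
      p ∈ Metric.ball s r := by
    filter_upwards [hφa.eventually_analyticAt, hcont.eventually (Metric.ball_mem_nhds 0 hr),
      hpair.eventually hW, Metric.ball_mem_nhds s hr] with p h1 h2 h3 h4
    exact ⟨h1, by simpa using h2, h3, h4⟩
  obtain ⟨ε, hε, hball⟩ := Metric.eventually_nhds_iff_ball.1 hev
  refine ⟨ε, r, φ, hε, fun p hp => ?_⟩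
  obtain ⟨h1, h2, h3, h4⟩ := hball p hp
  refine ⟨h1, h2, h3, fun x hx => ?_⟩
  rw [hiff (p, x) (by rw [← ball_prod_same]; exact ⟨h4, by simpa using hx⟩), eq_comm]

/-- Local solution branches whose uniqueness balls are all centred at the same point `0` fit
together: on the overlap of two domains the branch with the smaller ball lies in the larger one. -/
theorem exists_implicit {F : P × X → Y} {S : Set P} {W : Set (P × X)}
    (hF : ∀ s ∈ S, AnalyticAt ℝ F (s, 0)) (h0 : ∀ s ∈ S, F (s, 0) = 0)
    (hL : ∀ s ∈ S, ∃ L : X ≃L[ℝ] Y, HasFDerivAt (fun x => F (s, x)) (L : X →L[ℝ] Y) 0)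
    (hW : ∀ s ∈ S, W ∈ 𝓝 (s, (0 : X))) :
    ∃ (ε r : P → ℝ) (φ : P → X), ∀ s ∈ S, 0 < ε s ∧ ∀ p ∈ Metric.ball s (ε s),
      AnalyticAt ℝ φ p ∧ ‖φ p‖ < r s ∧ (p, φ p) ∈ W ∧
        ∀ x, ‖x‖ < r s → (F (p, x) = 0 ↔ x = φ p) := by
  classical
  have hloc : ∀ s : P, ∃ (ε r : ℝ) (φ : P → X), s ∈ S → 0 < ε ∧ ∀ p ∈ Metric.ball s ε,
      AnalyticAt ℝ φ p ∧ ‖φ p‖ < r ∧ (p, φ p) ∈ W ∧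
        ∀ x, ‖x‖ < r → (F (p, x) = 0 ↔ x = φ p) := by
    intro s
    by_cases hs : s ∈ S
    · obtain ⟨L, hL⟩ := hL s hs
      obtain ⟨ε, r, φ, h⟩ := exists_local_implicit (hF s hs) (h0 s hs) hL (hW s hs)
      exact ⟨ε, r, φ, fun _ => h⟩
    · exact ⟨0, 0, 0, fun h => (hs h).elim⟩
  choose ε r ψ h using hloc
  have hglue : ∀ s ∈ S, ∀ t ∈ S, ∀ p ∈ Metric.ball s (ε s), p ∈ Metric.ball t (ε t) →
      r s ≤ r t → ψ s p = ψ t p := by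
    intro s hs t ht p hps hpt hrs
    obtain ⟨-, h1, -, h2⟩ := (h s hs).2 p hps
    obtain ⟨-, -, -, h3⟩ := (h t ht).2 p hpt
    exact (h3 _ (h1.trans_le hrs)).1 ((h2 _ h1).2 rfl)
  let φ : P → X := fun p =>
    if hp : ∃ s ∈ S, p ∈ Metric.ball s (ε s) then ψ hp.choose p else 0
  have hφ : ∀ s ∈ S, ∀ p ∈ Metric.ball s (ε s), φ p = ψ s p := by
    intro s hs p hp
    have hex : ∃ s ∈ S, p ∈ Metric.ball s (ε s) := ⟨s, hs, hp⟩
    have hφp : φ p = ψ hex.choose p := dif_pos hex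
    rw [hφp]
    obtain ⟨ht, hpt⟩ := hex.choose_spec
    rcases le_total (r s) (r hex.choose) with hle | hle
    · exact (hglue s hs _ ht p hp hpt hle).symm
    · exact hglue _ ht s hs p hpt hp hle
  refine ⟨ε, r, φ, fun s hs => ⟨(h s hs).1, fun p hp => ?_⟩⟩
  rw [hφ s hs p hp]
  obtain ⟨h1, h2, h3, h4⟩ := (h s hs).2 p hp
  refine ⟨h1.congr ?_, h2, h3, h4⟩
  filter_upwards [Metric.isOpen_ball.mem_nhds hp] with q hq
  exact (hφ s hs q hq).symm

omit [CompleteSpace P] [CompleteSpace X] [CompleteSpace Y] in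
/-- The distance of an approximate solution to the solution branch is controlled by its residual. -/
theorem exists_residual_bound {F : P × X → Y} {s : P} {L : X ≃L[ℝ] Y} {φ : P → X}
    (hF : AnalyticAt ℝ F (s, 0)) (hL : HasFDerivAt (fun x => F (s, x)) (L : X →L[ℝ] Y) 0)
    (hφ : Tendsto φ (𝓝 s) (𝓝 0)) (hφ0 : ∀ᶠ p in 𝓝 s, F (p, φ p) = 0) :
    ∃ C, ∀ᶠ q : P × X in 𝓝 (s, 0), ‖q.2 - φ q.1‖ ≤ C * ‖F q‖ := by
  have hpart := partial_fderiv hF.differentiableAt hL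
  obtain ⟨K, hK⟩ : ∃ K : ℝ, 0 < K ∧ ∀ w, ‖w‖ ≤ K * ‖L w‖ := by
    refine ⟨‖(L.symm : Y →L[ℝ] X)‖ + 1, by positivity, fun w => ?_⟩
    have h := (L.symm : Y →L[ℝ] X).le_opNorm (L w)
    simp only [ContinuousLinearEquiv.coe_coe, ContinuousLinearEquiv.symm_apply_apply] at h
    nlinarith [norm_nonneg (L w)]
  obtain ⟨hK0, hK⟩ := hK
  have hstrict := hF.hasStrictFDerivAt
  have hlo := hstrict.isLittleO.def (c := 1 / (2 * K)) (by positivity)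
  have hfst : Tendsto (fun q : P × X => q.1) (𝓝 (s, 0)) (𝓝 s) := continuous_fst.continuousAt
  have htend : Tendsto (fun q : P × X => (q, (q.1, φ q.1))) (𝓝 (s, 0))
      (𝓝 ((s, 0), (s, 0))) := by
    rw [nhds_prod_eq (x := ((s, 0) : P × X))]
    refine tendsto_id.prodMk ?_
    have h := hfst.prodMk (hφ.comp hfst)
    rwa [← nhds_prod_eq] at h
  refine ⟨2 * K, ?_⟩
  filter_upwards [htend.eventually hlo, hfst.eventually hφ0] with q hq hq0
  have hsub : q - (q.1, φ q.1) = (0, q.2 - φ q.1) := by ext <;> simp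
  have hLw : fderiv ℝ F (s, 0) (0, q.2 - φ q.1) = L (q.2 - φ q.1) := by
    have := DFunLike.congr_fun hpart (q.2 - φ q.1)
    simpa using this
  simp only [hsub, hq0, sub_zero, hLw] at hq
  have hn : ‖((0 : P), q.2 - φ q.1)‖ = ‖q.2 - φ q.1‖ := by simp [Prod.norm_def]
  rw [hn] at hq
  have h1 : ‖L (q.2 - φ q.1)‖ ≤ ‖F q‖ + 1 / (2 * K) * ‖q.2 - φ q.1‖ := by
    have := norm_sub_le (F q) (F q - L (q.2 - φ q.1))
    rw [sub_sub_cancel] at this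
    linarith
  have h2 := (hK (q.2 - φ q.1)).trans (mul_le_mul_of_nonneg_left h1 hK0.le)
  have h3 : K * (‖F q‖ + 1 / (2 * K) * ‖q.2 - φ q.1‖) = K * ‖F q‖ + ‖q.2 - φ q.1‖ / 2 := by
    field_simp
  rw [h3] at h2
  linarith

end Implicit

/-! ### Functions that are even in one variable -/

section EvenTaylor

variable {B : Type*} [NormedAddCommGroup B] [NormedSpace ℝ B]

theorem deriv_eq_zero_of_even {f : ℝ → ℝ} {d : ℝ} (hf : HasDerivAt f d 0)
    (he : ∀ᶠ t in 𝓝 0, f (-t) = f t) : d = 0 := by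
  have h1 : HasDerivAt (fun t => f (-t)) (-d) 0 := by
    have := HasDerivAt.scomp (0 : ℝ) (h := fun t : ℝ => -t) (by simpa using hf) (hasDerivAt_neg 0)
    simpa [Function.comp_def] using this
  have := (h1.congr_of_eventuallyEq (f₁ := f) (he.mono fun t h => h.symm)).unique hf
  linarith

/-- An analytic function that is even in its first variable `a` equals, up to an error
`O(|a| ‖(a, b)‖²)`, its value at `a = 0` plus a constant multiple of `a²`: its derivative in `a`
vanishes on `a = 0`, hence has no linear term in `b`. -/
theorem even_taylor {G : ℝ × B → ℝ} (hG : AnalyticAt ℝ G 0)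
    (he : ∀ᶠ v in 𝓝 (0 : ℝ × B), G (-v.1, v.2) = G v) :
    ∃ l : ℝ, (fun v : ℝ × B => G v - G (0, v.2) - l * v.1 ^ 2) =O[𝓝 0]
      fun v => |v.1| * ‖v‖ ^ 2 := by
  have hDa : AnalyticAt ℝ (fun v => fderiv ℝ G v (1, 0)) 0 :=
    ((ContinuousLinearMap.apply ℝ ℝ ((1, 0) : ℝ × B)).analyticAt _).comp hG.fderiv
  have hdG : ∀ᶠ v in 𝓝 (0 : ℝ × B), HasDerivAt (fun t => G (t, v.2)) (fderiv ℝ G v (1, 0)) v.1 := by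
    filter_upwards [hG.eventually_analyticAt] with v hv
    have h1 : HasDerivAt (fun t : ℝ => (t, v.2)) ((1, 0) : ℝ × B) v.1 :=
      (hasDerivAt_id v.1).prodMk (hasDerivAt_const v.1 v.2)
    exact HasFDerivAt.comp_hasDerivAt (x := v.1) (l := G) (f := fun t : ℝ => (t, v.2))
      hv.differentiableAt.hasFDerivAt h1
  set D : ℝ × B → ℝ := fun v => fderiv ℝ G v (1, 0) with hD
  obtain ⟨p, hp⟩ := hDa
  set m : ℝ × B →L[ℝ] ℝ := continuousMultilinearCurryFin1 ℝ (ℝ × B) ℝ (p 1) with hm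
  have hO : (fun v => D v - D 0 - m v) =O[𝓝 0] fun v => ‖v‖ ^ 2 := by
    have := hp.isBigO_sub_partialSum_pow 2
    refine this.congr_left fun v => ?_
    have h0 : p 0 (fun _ => v) = D 0 := hp.coeff_zero _
    have h1 : p 1 (fun _ => v) = m v := rfl
    simp [FormalMultilinearSeries.partialSum, Finset.sum_range_succ, h0, h1]
    ring
  have hzero : ∀ᶠ v in 𝓝 (0 : ℝ × B), D (0, v.2) = 0 := by
    have ht : Tendsto (fun v : ℝ × B => ((0 : ℝ), v.2)) (𝓝 0) (𝓝 0) := by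
      have : Continuous (fun v : ℝ × B => ((0 : ℝ), v.2)) := by fun_prop
      exact this.tendsto' 0 0 (by simp)
    filter_upwards [ht.eventually hdG, ht.eventually he.eventually_nhds] with v hv1 hv2
    refine deriv_eq_zero_of_even hv1 ?_
    have : Tendsto (fun t : ℝ => (t, v.2)) (𝓝 0) (𝓝 (0, v.2)) := by
      have : Continuous (fun t : ℝ => (t, v.2)) := by fun_prop
      exact this.tendsto 0
    exact this.eventually hv2
  have hD0 : D 0 = 0 := hzero.self_of_nhds
  have hmb : ∀ b : B, m (0, b) = 0 := by
    intro b
    have ht : Tendsto (fun t : ℝ => ((0 : ℝ), t • b)) (𝓝 0) (𝓝 0) := by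
      have : Continuous (fun t : ℝ => ((0 : ℝ), t • b)) := by fun_prop
      exact this.tendsto' 0 0 (by simp)
    have h1 := hO.comp_tendsto ht
    have h2 : (fun t : ℝ => t * m (0, b)) =O[𝓝 0] fun t : ℝ => t ^ 2 := by
      have h3 : (fun t : ℝ => ‖(((0 : ℝ), t • b) : ℝ × B)‖ ^ 2) =O[𝓝 0] fun t : ℝ => t ^ 2 := by
        refine IsBigO.pow (IsBigO.of_bound ‖b‖ (Eventually.of_forall fun t => ?_)) 2
        have h0 : 0 ≤ |t| * ‖b‖ := by positivity
        simp [Prod.norm_def, norm_smul, mul_comm, max_eq_right h0]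
      refine IsBigO.trans (IsBigO.congr' h1 ?_ EventuallyEq.rfl) h3 |>.neg_left.congr_left
        (f₁ := fun t => -(-(t * m (0, b)))) (fun t => neg_neg _)
      filter_upwards [ht.eventually hzero] with t ht0
      have e : m (0, t • b) = t * m (0, b) := by
        rw [← smul_eq_mul, ← map_smul]; simp
      simp only [Function.comp_apply, hD0, e] at ht0 ⊢
      rw [ht0]; ring
    have h4 : (fun t : ℝ => t ^ 2) =o[𝓝 0] fun t : ℝ => t := by
      simpa using isLittleO_pow_pow (𝕜 := ℝ) (m := 1) (n := 2) (by norm_num)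
    have h5 := h2.trans_isLittleO h4
    by_contra hne
    have h6 : (fun t : ℝ => t) =o[𝓝 0] fun t : ℝ => t := by
      have := h5.const_mul_left (m (0, b))⁻¹
      refine this.congr_left fun t => ?_
      field_simp
    have h7 := h6.mono (nhdsWithin_le_nhds (s := {0}ᶜ))
    exact (isLittleO_irrefl (l := 𝓝[≠] (0 : ℝ)) (f'' := fun t : ℝ => t) (Filter.Eventually.frequently
      (eventually_mem_nhdsWithin.mono fun t ht => ht))) h7
  obtain ⟨C, hC⟩ := hO.bound
  refine ⟨m (1, 0) / 2, ?_⟩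
  obtain ⟨r, hr, hball⟩ := Metric.eventually_nhds_iff_ball.1 (hC.and hdG)
  refine IsBigO.of_bound C ?_
  filter_upwards [Metric.ball_mem_nhds (0 : ℝ × B) hr] with v hv
  rw [mem_ball_zero_iff] at hv
  have hseg : ∀ t ∈ segment ℝ 0 v.1, |t| ≤ |v.1| := by
    intro t ht
    rw [segment_eq_uIcc, Set.mem_uIcc] at ht
    rcases ht with ht | ht
    · rw [abs_of_nonneg ht.1, abs_of_nonneg (ht.1.trans ht.2)]; exact ht.2
    · rw [abs_of_nonpos ht.2, abs_of_nonpos (ht.1.trans ht.2)]; linarith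
  have hnorm : ∀ t ∈ segment ℝ 0 v.1, ‖(t, v.2)‖ ≤ ‖v‖ := by
    intro t ht
    rw [Prod.norm_def, Prod.norm_def]
    exact max_le_max (hseg t ht) le_rfl
  have hder : ∀ t ∈ segment ℝ 0 v.1, HasDerivWithinAt
      (fun t => G (t, v.2) - m (1, 0) / 2 * t ^ 2) (D (t, v.2) - m (1, 0) * t)
      (segment ℝ 0 v.1) t := by
    intro t ht
    have h1 := (hball (t, v.2) (mem_ball_zero_iff.2 ((hnorm t ht).trans_lt hv))).2
    have h2 := h1.sub ((hasDerivAt_pow 2 t).const_mul (m (1, 0) / 2))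
    refine (h2.congr_deriv ?_).hasDerivWithinAt
    simp only [hD]
    push_cast
    ring
  have hbd : ∀ t ∈ segment ℝ 0 v.1, ‖D (t, v.2) - m (1, 0) * t‖ ≤ C * ‖v‖ ^ 2 := by
    intro t ht
    have h1 := (hball (t, v.2) (mem_ball_zero_iff.2 ((hnorm t ht).trans_lt hv))).1
    have e : m (t, v.2) = m (1, 0) * t := by
      have : ((t, v.2) : ℝ × B) = t • (1, 0) + (0, v.2) := by ext <;> simp
      rw [this, map_add, map_smul, hmb, smul_eq_mul]; ring
    rw [hD0, e, sub_zero] at h1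
    refine h1.trans ?_
    have hC0 : 0 ≤ C ∨ ‖v‖ = 0 := by
      by_contra! hcon
      have h2 := (hball v (mem_ball_zero_iff.2 hv)).1
      have h3 : 0 < ‖v‖ := lt_of_le_of_ne (norm_nonneg v) hcon.2.symm
      have := (norm_nonneg _).trans h2
      rw [norm_pow, norm_norm] at this
      nlinarith [pow_pos h3 2]
    rw [norm_pow, norm_norm]
    rcases hC0 with hC0 | hv0
    · gcongr
      exact hnorm t ht
    · have := hnorm t ht
      rw [hv0] at this ⊢
      rw [le_antisymm this (norm_nonneg _)]
  have := (convex_segment (𝕜 := ℝ) (0 : ℝ) v.1).norm_image_sub_le_of_norm_hasDerivWithin_le hder hbd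
    (left_mem_segment ℝ 0 v.1) (right_mem_segment ℝ 0 v.1)
  simp only [norm_mul, Real.norm_eq_abs, abs_abs, norm_pow, abs_norm, sub_zero] at this ⊢
  calc _ = _ := by congr 1; ring
    _ ≤ _ := this
    _ = _ := by ring

end EvenTaylor

/-! ### The desingularized system -/

/-- The parameters `(a, κ, b₁, b₂)`. -/
abbrev Param : Type := ℝ × ℝ × ℝ × ℝ

/-- The unknowns `(m, w, g, α, β)`, see `sys`. -/
abbrev Unknown : Type := ℝ × ℝ × ℝ × Coeff × Coeff

/-- The system solved by `η = m + a (cos z + α)`, `u = w + a (cww κ cos z + β)` and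
`c = cww κ + g`: the equations for the constants `m`, `w`, the normalization that fixes the
first Fourier coefficient of `η`, and the remainders of the two wave equations, divided by `a`.
The shifts by `cos z`, `cww κ cos z` and `cww κ` put the solution at `a = b₁ = b₂ = 0` at the
origin for every `κ`. -/
noncomputable def sysFun (a κ b₁ b₂ m w g : ℝ) (α β : Coeff) : Unknown :=
  (-(cww κ + g) * m + w + w * m - (1 - (cww κ + g) ^ 2) * b₁,
    -(cww κ + g) * w + m + w ^ 2 / 2 - (1 - (cww κ + g) ^ 2) * b₂,
    coord 1 α / 2 - (b₁ * cww κ + b₂),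
    (w - (cww κ + g)) • (cosMode 1 + α) + (1 + m) • (cww κ • cosMode 1 + β) +
      a • mul (cww κ • cosMode 1 + β) (cosMode 1 + α),
    (w - (cww κ + g)) • (cww κ • cosMode 1 + β) + dispOp κ (cosMode 1 + α) +
      (a / 2) • mul (cww κ • cosMode 1 + β) (cww κ • cosMode 1 + β))

/-- `sysFun` as a function of the pair of parameters and unknowns. -/
noncomputable def sys (q : Param × Unknown) : Unknown :=
  sysFun q.1.1 q.1.2.1 q.1.2.2.1 q.1.2.2.2 q.2.1 q.2.2.1 q.2.2.2.1 q.2.2.2.2.1 q.2.2.2.2.2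

attribute [local fun_prop] analyticAt_fst analyticAt_snd in
theorem analyticAt_sys {q : Param × Unknown} (hκ : 0 < q.1.2.1) : AnalyticAt ℝ sys q := by
  have hcw : AnalyticAt ℝ (fun q : Param × Unknown => cww q.1.2.1) q :=
    (analyticAt_cww hκ).comp (f := fun q : Param × Unknown => q.1.2.1) (by fun_prop)
  have hdisp : AnalyticAt ℝ (fun q : Param × Unknown => dispOp q.1.2.1) q :=
    (analyticAt_dispOp hκ).comp (f := fun q : Param × Unknown => q.1.2.1) (by fun_prop)
  have hcoord : AnalyticAt ℝ (fun q : Param × Unknown => coord 1 q.2.2.2.2.1) q :=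
    ((coord 1).analyticAt _).comp (f := fun q : Param × Unknown => q.2.2.2.2.1) (by fun_prop)
  have hη : AnalyticAt ℝ (fun q : Param × Unknown => cosMode 1 + q.2.2.2.2.1) q := by fun_prop
  have hu : AnalyticAt ℝ (fun q : Param × Unknown => cww q.1.2.1 • cosMode 1 + q.2.2.2.2.2) q := by
    fun_prop
  have hmul : ∀ f g : Param × Unknown → Coeff, AnalyticAt ℝ f q → AnalyticAt ℝ g q →
      AnalyticAt ℝ (fun q => mul (f q) (g q)) q := fun f g hf hg =>
    (mul.analyticAt_bilinear (f q, g q)).comp₂ hf hg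
  have hdη : AnalyticAt ℝ (fun q : Param × Unknown =>
      dispOp q.1.2.1 (cosMode 1 + q.2.2.2.2.1)) q :=
    ((ContinuousLinearMap.id ℝ (Coeff →L[ℝ] Coeff)).analyticAt_bilinear
      (dispOp q.1.2.1, cosMode 1 + q.2.2.2.2.1)).comp₂ hdisp hη
  have h1 := hmul _ _ hu hη
  have h2 := hmul _ _ hu hu
  unfold sys sysFun
  fun_prop

/-- The linear part of `sys` in the unknowns. -/
noncomputable def linOp (κ : ℝ) : Unknown →L[ℝ] Unknown where
  toFun x := (-cww κ * x.1 + x.2.1, -cww κ * x.2.1 + x.1, coord 1 x.2.2.2.1 / 2,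
    (x.2.1 - x.2.2.1 + x.1 * cww κ) • cosMode 1 - cww κ • x.2.2.2.1 + x.2.2.2.2,
    ((x.2.1 - x.2.2.1) * cww κ) • cosMode 1 - cww κ • x.2.2.2.2 + dispOp κ x.2.2.2.1)
  map_add' x y := by
    simp only [Prod.fst_add, Prod.snd_add, map_add, Prod.mk_add_mk, Prod.mk.injEq]
    refine ⟨by ring, by ring, by ring, by module, by module⟩
  map_smul' r x := by
    simp only [Prod.smul_fst, Prod.smul_snd, map_smul, Prod.smul_mk, Prod.mk.injEq,
      RingHom.id_apply, smul_eq_mul]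
    refine ⟨by ring, by ring, by ring, by module, by module⟩
  cont := by fun_prop

theorem linOp_apply (κ m w g : ℝ) (α β : Coeff) : linOp κ (m, w, g, α, β) =
    (-cww κ * m + w, -cww κ * w + m, coord 1 α / 2,
      (w - g + m * cww κ) • cosMode 1 - cww κ • α + β,
      ((w - g) * cww κ) • cosMode 1 - cww κ • β + dispOp κ α) := rfl

/-- The part of `sys` that is linear in the small parameters `(a, b₁, b₂)`. -/
noncomputable def parPart (κ : ℝ) (v : ℝ × ℝ × ℝ) : Unknown :=
  (-((1 - cww κ ^ 2) * v.2.1), -((1 - cww κ ^ 2) * v.2.2), -(v.2.1 * cww κ + v.2.2),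
    (v.1 * cww κ) • mul (cosMode 1) (cosMode 1),
    (v.1 / 2 * cww κ ^ 2) • mul (cosMode 1) (cosMode 1))

/-- The part of `sys` of second and higher order in `(a, b₁, b₂)` and the unknowns together. -/
noncomputable def quadPart (κ : ℝ) (q : (ℝ × ℝ × ℝ) × Unknown) : Unknown :=
  (-q.2.2.2.1 * q.2.1 + q.2.2.1 * q.2.1 + (2 * cww κ + q.2.2.2.1) * (q.2.2.2.1 * q.1.2.1),
    -q.2.2.2.1 * q.2.2.1 + q.2.2.1 * q.2.2.1 / 2 +
      (2 * cww κ + q.2.2.2.1) * (q.2.2.2.1 * q.1.2.2),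
    0,
    (q.2.2.1 - q.2.2.2.1) • q.2.2.2.2.1 + q.2.1 • q.2.2.2.2.2 +
      q.1.1 • (mul q.2.2.2.2.2 (cosMode 1) + cww κ • mul (cosMode 1) q.2.2.2.2.1 +
        mul q.2.2.2.2.2 q.2.2.2.2.1),
    (q.2.2.1 - q.2.2.2.1) • q.2.2.2.2.2 +
      (q.1.1 / 2) • (cww κ • mul (cosMode 1) q.2.2.2.2.2 + cww κ • mul q.2.2.2.2.2 (cosMode 1) +
        mul q.2.2.2.2.2 q.2.2.2.2.2))

/-- Inserting a fixed `κ` into the small parameters `(a, b₁, b₂)`. -/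
def withκ (κ : ℝ) (v : ℝ × ℝ × ℝ) : Param := (v.1, κ, v.2.1, v.2.2)

/-- The equations have no zeroth order part: `cos z` with amplitude ratio `cww κ` solves the
linearized wave equations at speed `cww κ`. -/
theorem sys_decomp (κ : ℝ) (v : ℝ × ℝ × ℝ) (x : Unknown) :
    sys (withκ κ v, x) = linOp κ x + parPart κ v + quadPart κ (v, x) := by
  obtain ⟨a, b₁, b₂⟩ := v
  obtain ⟨m, w, g, α, β⟩ := x
  have hE : dispOp κ (cosMode 1) = cww κ ^ 2 • cosMode 1 := by simp [dispOp_cosMode]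
  simp only [sys, sysFun, withκ, linOp_apply, parPart, quadPart, Prod.mk_add_mk, Prod.mk.injEq,
    map_add, map_smul, _root_.add_apply, _root_.smul_apply, hE]
  refine ⟨by ring, by ring, by ring, by module, by module⟩

theorem quadPart_isBigO (κ : ℝ) :
    quadPart κ =O[𝓝 0] fun q : (ℝ × ℝ × ℝ) × Unknown => ‖q‖ ^ 2 := by
  set l : Filter ((ℝ × ℝ × ℝ) × Unknown) := 𝓝 0
  set n : (ℝ × ℝ × ℝ) × Unknown → ℝ := fun q => ‖q‖ with hn
  have h0 : (fun q : (ℝ × ℝ × ℝ) × Unknown => q) =O[l] n := isBigO_norm_right.2 (isBigO_refl _ _)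
  have hv := h0.prod_left_fst
  have hx := h0.prod_left_snd
  have ha := hv.prod_left_fst
  have hb₁ := hv.prod_left_snd.prod_left_fst
  have hb₂ := hv.prod_left_snd.prod_left_snd
  have hm := hx.prod_left_fst
  have hw := hx.prod_left_snd.prod_left_fst
  have hg := hx.prod_left_snd.prod_left_snd.prod_left_fst
  have hα := hx.prod_left_snd.prod_left_snd.prod_left_snd.prod_left_fst
  have hβ := hx.prod_left_snd.prod_left_snd.prod_left_snd.prod_left_snd
  have hone : ∀ {F : Type} [NormedAddCommGroup F] (f : (ℝ × ℝ × ℝ) × Unknown → F),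
      ContinuousAt f 0 → f =O[l] fun _ => (1 : ℝ) := fun f hf => hf.isBigO_one ℝ
  have hsq : ∀ {F : Type} [NormedAddCommGroup F] {f : (ℝ × ℝ × ℝ) × Unknown → F},
      f =O[l] (fun q => n q * n q) → f =O[l] fun q => n q ^ 2 :=
    fun h => h.congr_right fun q => (sq _).symm
  have hbil : ∀ {f g : (ℝ × ℝ × ℝ) × Unknown → Coeff} {s t : (ℝ × ℝ × ℝ) × Unknown → ℝ},
      f =O[l] s → g =O[l] t → (fun q => mul (f q) (g q)) =O[l] fun q => s q * t q := by
    intro f g s t hf hg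
    have : (fun q => mul (f q) (g q)) =O[l] fun q => ‖f q‖ * ‖g q‖ :=
      IsBigO.of_bound ‖mul‖ (Eventually.of_forall fun q => by
        simpa [mul_assoc] using mul.le_opNorm₂ (f q) (g q))
    exact this.trans (hf.norm_left.mul hg.norm_left)
  have hE : (fun _ : (ℝ × ℝ × ℝ) × Unknown => cosMode 1) =O[l] fun _ => (1 : ℝ) :=
    hone _ continuousAt_const
  have hβ1 := hone (fun q : (ℝ × ℝ × ℝ) × Unknown => q.2.2.2.2.2)
    (by fun_prop)
  have hc1 := hone (fun q : (ℝ × ℝ × ℝ) × Unknown => 2 * cww κ + q.2.2.2.1)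
    (by fun_prop)
  have e1 : ∀ {F : Type} [NormedAddCommGroup F] {f : (ℝ × ℝ × ℝ) × Unknown → F},
      f =O[l] (fun q => 1 * n q) → f =O[l] n := fun h => h.congr_right fun q => one_mul _
  have e2 : ∀ {F : Type} [NormedAddCommGroup F] {f : (ℝ × ℝ × ℝ) × Unknown → F},
      f =O[l] (fun q => n q * 1) → f =O[l] n := fun h => h.congr_right fun q => mul_one _
  have e3 : ∀ {F : Type} [NormedAddCommGroup F] {f : (ℝ × ℝ × ℝ) × Unknown → F},
      f =O[l] (fun q => 1 * (n q * n q)) → f =O[l] fun q => n q * n q :=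
    fun h => h.congr_right fun q => one_mul _
  refine hsq (((hg.neg_left.mul hm).add (hw.mul hm)).add (e3 (hc1.mul (hg.mul hb₁))) |>.prod_left ?_)
  refine IsBigO.prod_left ?_ (IsBigO.prod_left (isBigO_zero _ _) (IsBigO.prod_left ?_ ?_))
  · refine ((hg.neg_left.mul hw).add ?_).add (e3 (hc1.mul (hg.mul hb₂)))
    exact ((hw.mul hw).const_mul_left (1 / 2)).congr_left fun q => by ring
  · refine (((hw.sub hg).smul hα).add (hm.smul hβ)).add (ha.smul ?_)
    exact ((e2 (hbil hβ hE)).add ((e1 (hbil hE hα)).const_smul_left (cww κ))).add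
      (e1 (hbil hβ1 hα))
  · have ha2 : (fun q : (ℝ × ℝ × ℝ) × Unknown => q.1.1 / 2) =O[l] n :=
      (ha.const_mul_left (1 / 2)).congr_left fun q => by ring
    refine ((hw.sub hg).smul hβ).add (ha2.smul ?_)
    exact (((e1 (hbil hE hβ)).const_smul_left (cww κ)).add
      ((e2 (hbil hβ hE)).const_smul_left (cww κ))).add (e1 (hbil hβ1 hβ))

theorem quadPart_zero (κ : ℝ) : quadPart κ 0 = 0 := by simp [quadPart]

theorem parPart_zero (κ : ℝ) : parPart κ 0 = 0 := by simp [parPart]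

theorem sys_base (κ : ℝ) : sys ((0, κ, 0, 0), 0) = 0 := by
  have := sys_decomp κ 0 0
  rw [map_zero, parPart_zero, ← Prod.zero_eq_mk, quadPart_zero, add_zero, add_zero] at this
  exact this

theorem hasFDerivAt_sys (κ : ℝ) :
    HasFDerivAt (fun x => sys ((0, κ, 0, 0), x)) (linOp κ) 0 := by
  have h1 : (fun x => sys ((0, κ, 0, 0), x)) = fun x => linOp κ x + quadPart κ (0, x) := by
    funext x
    have := sys_decomp κ 0 x
    rw [parPart_zero, add_zero] at this
    exact this
  have ht : Tendsto (fun x : Unknown => ((0 : ℝ × ℝ × ℝ), x)) (𝓝 0) (𝓝 0) := by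
    have : Continuous (fun x : Unknown => ((0 : ℝ × ℝ × ℝ), x)) := by fun_prop
    exact this.tendsto' 0 0 rfl
  have h2 : HasFDerivAt (fun x : Unknown => quadPart κ (0, x)) (0 : Unknown →L[ℝ] Unknown) 0 := by
    refine IsBigO.hasFDerivAt (𝕜 := ℝ) (n := 2) ?_ (by norm_num)
    have := (quadPart_isBigO κ).comp_tendsto ht
    refine this.congr_right fun x => ?_
    simp [Prod.norm_mk]
  rw [h1]
  refine ((linOp κ).hasFDerivAt.add h2).congr_fderiv ?_
  rw [add_zero]

/-! ### Invertibility of the linear part -/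

theorem cww_sq_mul_ne {κ : ℝ} (hκ : 0 < κ) {n : ℕ} (hn : n ≠ 1) :
    cww (n * κ) ^ 2 - cww κ ^ 2 ≠ 0 := by
  rcases Nat.lt_or_gt_of_ne hn with h | h
  · obtain rfl : n = 0 := by omega
    have := cww_sq_lt_one hκ
    simp only [Nat.cast_zero, zero_mul, cww_zero]
    linarith
  · have hn2 : (1 : ℝ) < n := by exact_mod_cast h
    have : κ < n * κ := by nlinarith
    exact (sub_neg.2 (cww_sq_strictAntiOn hκ (hκ.trans this) this)).ne

/-- The reciprocals `1 / (cww² (nκ) - cww² κ)`, `n ≠ 1`, are bounded since `cww²` is strictly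
decreasing. For `n = 1` the entry is `1 / 0 = 0`. -/
theorem exists_bound_inv_cww_sq {κ : ℝ} (hκ : 0 < κ) :
    ∃ C, ∀ n : ℕ, |(cww (n * κ) ^ 2 - cww κ ^ 2)⁻¹| ≤ C := by
  have h2 : cww (2 * κ) ^ 2 < cww κ ^ 2 :=
    cww_sq_strictAntiOn hκ (Set.mem_Ioi.2 (by linarith)) (by linarith)
  have h1 := cww_sq_lt_one hκ
  have hp1 : 0 < (1 - cww κ ^ 2)⁻¹ := inv_pos.2 (by linarith)
  have hp2 : 0 < (cww κ ^ 2 - cww (2 * κ) ^ 2)⁻¹ := inv_pos.2 (by linarith)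
  refine ⟨(1 - cww κ ^ 2)⁻¹ + (cww κ ^ 2 - cww (2 * κ) ^ 2)⁻¹, fun n => ?_⟩
  obtain rfl | rfl | hn : n = 0 ∨ n = 1 ∨ 2 ≤ n := by omega
  · simp only [Nat.cast_zero, zero_mul, cww_zero, one_pow]
    rw [abs_of_pos hp1]
    linarith
  · simp only [Nat.cast_one, one_mul, sub_self, inv_zero, abs_zero]
    linarith
  · have hn2 : (2 : ℝ) ≤ n := by exact_mod_cast hn
    have hle : cww (n * κ) ^ 2 ≤ cww (2 * κ) ^ 2 :=
      cww_sq_strictAntiOn.antitoneOn (Set.mem_Ioi.2 (by linarith))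
        (Set.mem_Ioi.2 (by nlinarith)) (by nlinarith)
    rw [abs_inv, abs_of_neg (by linarith), neg_sub]
    have := inv_anti₀ (show 0 < cww κ ^ 2 - cww (2 * κ) ^ 2 by linarith)
      (show cww κ ^ 2 - cww (2 * κ) ^ 2 ≤ cww κ ^ 2 - cww (n * κ) ^ 2 by linarith)
    linarith

theorem linOp_injective {κ : ℝ} (hκ : 0 < κ) : Function.Injective (linOp κ) := by
  rw [injective_iff_map_eq_zero]
  rintro ⟨m, w, g, α, β⟩ h
  rw [linOp_apply] at h
  simp only [Prod.mk_eq_zero] at h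
  obtain ⟨h1, h2, h3, h4, h5⟩ := h
  have hc := cww_pos hκ
  have hc1 := cww_sq_lt_one hκ
  have hm : m = 0 := by
    have : (1 - cww κ ^ 2) * m = 0 := by linear_combination cww κ * h1 + h2
    exact (mul_eq_zero.1 this).resolve_left (by linarith)
  subst hm
  have hw : w = 0 := by linarith
  subst hw
  have k4 : ∀ n, -g * (if 1 = n then 2 ^ n else 0) - cww κ * coord n α + coord n β = 0 := fun n => by
    have := congrArg (coord n) h4
    simpa only [map_sub, map_add, map_smul, map_zero, smul_eq_mul, coord_cosMode, zero_mul,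
      zero_sub, add_zero] using this
  have k5 : ∀ n, -g * cww κ * (if 1 = n then 2 ^ n else 0) - cww κ * coord n β +
      cww (n * κ) ^ 2 * coord n α = 0 := fun n => by
    have := congrArg (coord n) h5
    simpa only [map_sub, map_add, map_smul, map_zero, smul_eq_mul, coord_cosMode, coord_dispOp,
      zero_sub] using this
  have hα1 : coord 1 α = 0 := by linarith
  have k41 := k4 1
  have k51 := k5 1
  simp only [hα1, if_true, pow_one, mul_zero, sub_zero, add_zero] at k41 k51
  have hg : g = 0 := by
    have : cww κ * g = 0 := by linear_combination -(1 / 4) * (k51 + cww κ * k41)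
    exact (mul_eq_zero.1 this).resolve_left hc.ne'
  subst hg
  have hα : ∀ n, coord n α = 0 := fun n => by
    by_cases hn : n = 1
    · rw [hn, hα1]
    · have : (cww (n * κ) ^ 2 - cww κ ^ 2) * coord n α = 0 := by
        linear_combination k5 n + cww κ * k4 n
      exact (mul_eq_zero.1 this).resolve_left (cww_sq_mul_ne hκ hn)
  have hβ : ∀ n, coord n β = 0 := fun n => by
    have := k4 n
    simp only [hα, neg_zero, zero_mul, mul_zero, sub_zero, zero_add] at this
    exact this
  have hα' : α = 0 := coeff_ext fun n => by simp [hα]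
  have hβ' : β = 0 := coeff_ext fun n => by simp [hβ]
  simp [hα', hβ']

theorem linOp_surjective {κ : ℝ} (hκ : 0 < κ) : Function.Surjective (linOp κ) := by
  rintro ⟨r₁, r₂, r₃, R₄, R₅⟩
  have hc := cww_pos hκ
  have hc1 := cww_sq_lt_one hκ
  have hd : 1 - cww κ ^ 2 ≠ 0 := by linarith
  set m := (cww κ * r₁ + r₂) / (1 - cww κ ^ 2) with hm
  set w := (r₁ + cww κ * r₂) / (1 - cww κ ^ 2) with hw
  set S₄ := R₄ - (w + m * cww κ) • cosMode 1 with hS₄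
  set T := R₅ - (w * cww κ) • cosMode 1 + cww κ • S₄ with hT
  set g := -(coord 1 T) / (4 * cww κ) with hg
  set D := multiplier (fun n : ℕ => (cww (n * κ) ^ 2 - cww κ ^ 2)⁻¹) (exists_bound_inv_cww_sq hκ)
    with hD
  -- `D` inverts `dispOp κ - cww κ ^ 2` off the first mode; the choice of `g` removes that mode.
  set α := D T + r₃ • cosMode 1 with hα
  set β := S₄ + g • cosMode 1 + cww κ • α with hβ
  have key : dispOp κ α - cww κ ^ 2 • α = T + (2 * g * cww κ) • cosMode 1 := by
    refine coeff_ext fun n => ?_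
    simp only [map_sub, map_add, map_smul, coord_dispOp, hα, hD, coord_multiplier, coord_cosMode,
      smul_eq_mul]
    by_cases hn : n = 1
    · subst hn
      simp only [Nat.cast_one, one_mul, if_true, pow_one, hg]
      field_simp
      ring
    · have := cww_sq_mul_ne hκ hn
      simp only [if_neg (Ne.symm hn), mul_zero, add_zero]
      field_simp
  refine ⟨(m, w, g, α, β), ?_⟩
  rw [linOp_apply]
  simp only [Prod.mk.injEq]
  refine ⟨?_, ?_, ?_, ?_, ?_⟩
  · rw [hm, hw]; field_simp; ring
  · rw [hm, hw]; field_simp; ring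
  · have h1 : coord 1 (D T) = 0 := by simp [hD, coord_multiplier]
    rw [hα, map_add, map_smul, h1, coord_cosMode]
    simp
  · rw [hβ, hS₄]; module
  · have : dispOp κ α = cww κ ^ 2 • α + (T + (2 * g * cww κ) • cosMode 1) := by
      rw [← key]; abel
    rw [this, hβ, hT]; module

/-- The linear part of `sys` as an isomorphism. -/
noncomputable def linEquiv {κ : ℝ} (hκ : 0 < κ) : Unknown ≃L[ℝ] Unknown :=
  ContinuousLinearEquiv.ofBijective (linOp κ) (LinearMap.ker_eq_bot.2 (linOp_injective hκ))
    (LinearMap.range_eq_top.2 (linOp_surjective hκ))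

theorem hasFDerivAt_sys_equiv {κ : ℝ} (hκ : 0 < κ) :
    HasFDerivAt (fun x => sys ((0, κ, 0, 0), x)) (linEquiv hκ : Unknown →L[ℝ] Unknown) 0 := by
  rw [linEquiv, ContinuousLinearEquiv.coe_ofBijective]
  exact hasFDerivAt_sys κ

/-! ### The solution branch and its reflection symmetry -/

/-- The translation `z ↦ z + π` on coefficient sequences. -/
noncomputable def halfShift : Coeff →L[ℝ] Coeff :=
  multiplier (fun n => (-1) ^ n) ⟨1, fun n => by simp⟩

theorem halfShift_mul (x y : Coeff) : mul (halfShift x) (halfShift y) = halfShift (mul x y) := by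
  have hm : ∀ m n : ℕ, halfShift (modeMul m n) = ((-1 : ℝ) ^ m * (-1) ^ n) • modeMul m n := by
    intro m n
    have h : (-1 : ℝ) ^ (max m n - min m n) = (-1) ^ m * (-1) ^ n := by
      rw [← pow_add]
      refine neg_one_pow_congr ?_
      rcases le_total m n with h | h
      · simp [h, Nat.even_sub h, Nat.even_add, iff_comm]
      · simp [h, Nat.even_sub h, Nat.even_add]
    simp only [modeMul, map_add, map_smul, halfShift, multiplier_mode, h, smul_add, smul_smul,
      pow_add]
    congr 2 <;> ring
  have h1 : ∀ m : ℕ, (mul (halfShift (mode m))).comp halfShift = halfShift.comp (mul (mode m)) := by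
    refine fun m => clm_ext fun n => ?_
    simp only [ContinuousLinearMap.comp_apply, mul_mode, hm]
    simp [halfShift, smul_smul, mul_comm]
  have h2 : (mul.flip (halfShift y)).comp halfShift = halfShift.comp (mul.flip y) := by
    refine clm_ext fun m => ?_
    exact DFunLike.congr_fun (h1 m) y
  exact DFunLike.congr_fun h2 x

theorem halfShift_dispOp (κ : ℝ) (x : Coeff) :
    dispOp κ (halfShift x) = halfShift (dispOp κ x) := by
  refine coeff_ext fun n => ?_
  simp only [coord_dispOp, halfShift, coord_multiplier]
  ring

theorem halfShift_cosMode_one : halfShift (cosMode 1) = -cosMode 1 := by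
  simp [halfShift, multiplier_cosMode]

theorem norm_halfShift_le (x : Coeff) : ‖halfShift x‖ ≤ ‖x‖ := by
  have h : ‖halfShift‖ ≤ 1 := norm_multiplier_le fun n => by simp
  simpa using halfShift.le_of_opNorm_le h x

/-- The action on the unknowns of the symmetry `a ↦ -a`: the waves are translated by `π`. -/
noncomputable def reflect (x : Unknown) : Unknown :=
  (x.1, x.2.1, x.2.2.1, -halfShift x.2.2.2.1, -halfShift x.2.2.2.2)

theorem norm_reflect_le (x : Unknown) : ‖reflect x‖ ≤ ‖x‖ := by
  simp only [reflect, Prod.norm_def, norm_neg]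
  gcongr
  · exact norm_halfShift_le _
  · exact norm_halfShift_le _

theorem sys_reflect (a κ b₁ b₂ : ℝ) (x : Unknown) :
    sys ((-a, κ, b₁, b₂), reflect x) = reflect (sys ((a, κ, b₁, b₂), x)) := by
  obtain ⟨m, w, g, α, β⟩ := x
  have h1 : cosMode 1 + -halfShift α = -halfShift (cosMode 1 + α) := by
    rw [map_add, halfShift_cosMode_one]; abel
  have h2 : cww κ • cosMode 1 + -halfShift β = -halfShift (cww κ • cosMode 1 + β) := by
    rw [map_add, map_smul, halfShift_cosMode_one]; module
  have h3 : coord 1 (-halfShift α) = coord 1 α := by simp [halfShift, coord_multiplier]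
  simp only [sys, sysFun, reflect, h1, h2, h3]
  generalize cosMode 1 + α = X
  generalize cww κ • cosMode 1 + β = Y
  simp only [map_neg, _root_.neg_apply, halfShift_mul, halfShift_dispOp, map_add, map_smul,
    Prod.mk.injEq, true_and]
  refine ⟨by module, by module⟩

/-- The branch of solutions near `a = b₁ = b₂ = 0`. -/
theorem exists_branch : ∃ (U : Set Param) (φ : Param → Unknown), IsOpen U ∧
    (∀ κ : ℝ, 0 < κ → ((0, κ, 0, 0) : Param) ∈ U ∧ φ (0, κ, 0, 0) = 0) ∧
    AnalyticOnNhd ℝ φ U ∧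
    ∀ a κ b₁ b₂ : ℝ, (a, κ, b₁, b₂) ∈ U → 0 < κ ∧ (-a, κ, b₁, b₂) ∈ U ∧
      sys ((a, κ, b₁, b₂), φ (a, κ, b₁, b₂)) = 0 ∧ 0 < cww κ + (φ (a, κ, b₁, b₂)).2.2.1 ∧
      φ (-a, κ, b₁, b₂) = reflect (φ (a, κ, b₁, b₂)) := by
  set S : Set Param := {p | ∃ κ : ℝ, 0 < κ ∧ p = (0, κ, 0, 0)} with hS
  set W : Set (Param × Unknown) := {q | 0 < q.1.2.1 ∧ 0 < cww q.1.2.1 + q.2.2.2.1} with hW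
  obtain ⟨ε, r, φ, h⟩ := exists_implicit (F := sys) (S := S) (W := W)
    (by rintro _ ⟨κ, hκ, rfl⟩; exact analyticAt_sys hκ)
    (by rintro _ ⟨κ, hκ, rfl⟩; exact sys_base κ)
    (by rintro _ ⟨κ, hκ, rfl⟩; exact ⟨linEquiv hκ, hasFDerivAt_sys_equiv hκ⟩)
    (by
      rintro _ ⟨κ, hκ, rfl⟩
      have h1 : ContinuousAt (fun q : Param × Unknown => q.1.2.1) ((0, κ, 0, 0), 0) := by fun_prop
      have h2 : ContinuousAt (fun q : Param × Unknown => cww q.1.2.1 + q.2.2.2.1)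
          ((0, κ, 0, 0), 0) :=
        (ContinuousAt.comp' (f := fun q : Param × Unknown => q.1.2.1) (g := cww)
          (analyticAt_cww hκ).continuousAt h1).add (by fun_prop)
      exact (h1.eventually (lt_mem_nhds hκ)).and
        (h2.eventually (lt_mem_nhds (by simpa using cww_pos hκ))))
  have hbase : ∀ s ∈ S, s ∈ Metric.ball s (ε s) := fun s hs => Metric.mem_ball_self (h s hs).1
  refine ⟨⋃ s ∈ S, Metric.ball s (ε s), φ, isOpen_biUnion fun s _ => Metric.isOpen_ball,
    fun κ hκ => ?_, ?_, ?_⟩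
  · have hs : ((0, κ, 0, 0) : Param) ∈ S := ⟨κ, hκ, rfl⟩
    obtain ⟨-, h2, -, h3⟩ := (h _ hs).2 _ (hbase _ hs)
    exact ⟨Set.mem_biUnion hs (hbase _ hs),
      ((h3 0 (by rw [norm_zero]; exact (norm_nonneg _).trans_lt h2)).1 (sys_base κ)).symm⟩
  · intro p hp
    obtain ⟨s, hs, hps⟩ := Set.mem_iUnion₂.1 hp
    exact ((h s hs).2 p hps).1
  · intro a κ b₁ b₂ hp
    obtain ⟨s, hs, hps⟩ := Set.mem_iUnion₂.1 hp
    have hps' : ((-a, κ, b₁, b₂) : Param) ∈ Metric.ball s (ε s) := by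
      obtain ⟨κ', -, rfl⟩ := hs
      rw [mem_ball_iff_norm] at hps ⊢
      simpa [Prod.norm_def] using hps
    obtain ⟨-, h2, h3, h4⟩ := (h s hs).2 _ hps
    obtain ⟨-, -, -, k4⟩ := (h s hs).2 _ hps'
    have hz := (h4 _ h2).2 rfl
    refine ⟨h3.1, Set.mem_biUnion hs hps', hz, h3.2, ?_⟩
    refine ((k4 _ ((norm_reflect_le _).trans_lt h2)).1 ?_).symm
    rw [sys_reflect, hz]
    simp [reflect]

/-! ### Expansion of the branch to first order -/

/-- The linear approximation of the branch in `(a, b₁, b₂)`. -/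
noncomputable def firstOrder (κ : ℝ) (v : ℝ × ℝ × ℝ) : Unknown :=
  (v.2.1 * cww κ + v.2.2, v.2.1 + v.2.2 * cww κ,
    v.2.1 * (1 / 2 * cww κ ^ 2 + 1) + 3 / 2 * v.2.2 * cww κ,
    (v.2.1 * cww κ + v.2.2) • cosMode 1 + v.1 • (h0 κ • cosMode 0 + h2 κ • cosMode 2),
    (1 / 2 * cww κ * (v.2.1 * cww κ + v.2.2)) • cosMode 1 +
      (v.1 * cww κ) • ((h0 κ - 1 / 2) • cosMode 0 + (h2 κ - 1 / 2) • cosMode 2))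

theorem mul_cosMode_one_one :
    mul (cosMode 1) (cosMode 1) = (1 / 2 : ℝ) • cosMode 2 + (1 / 2 : ℝ) • cosMode 0 :=
  mul_cosMode 1 1

theorem linOp_firstOrder {κ : ℝ} (hκ : 0 < κ) (v : ℝ × ℝ × ℝ) :
    linOp κ (firstOrder κ v) + parPart κ v = 0 := by
  obtain ⟨a, b₁, b₂⟩ := v
  have H0 : h0 κ * (1 - cww κ ^ 2) + 3 / 4 * cww κ ^ 2 = 0 := by
    have : cww κ ^ 2 - 1 ≠ 0 := (sub_neg.2 (cww_sq_lt_one hκ)).ne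
    rw [h0]; field_simp; ring
  have H2 : h2 κ * (cww (2 * κ) ^ 2 - cww κ ^ 2) + 3 / 4 * cww κ ^ 2 = 0 := by
    have : cww κ ^ 2 - cww (2 * κ) ^ 2 ≠ 0 := by
      have := cww_sq_mul_ne hκ (n := 2) (by norm_num)
      rw [← neg_sub]
      exact neg_ne_zero.2 (by simpa using this)
    rw [h2]; field_simp; ring
  have d0 : dispOp κ (cosMode 0) = cosMode 0 := by simp [dispOp_cosMode, cww_zero]
  have d1 : dispOp κ (cosMode 1) = cww κ ^ 2 • cosMode 1 := by simp [dispOp_cosMode]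
  have d2 : dispOp κ (cosMode 2) = cww (2 * κ) ^ 2 • cosMode 2 := by simp [dispOp_cosMode]
  simp only [firstOrder, linOp_apply, parPart, mul_cosMode_one_one, map_add, map_smul, d0, d1, d2,
    coord_cosMode, Prod.mk_add_mk, Prod.mk_eq_zero]
  refine ⟨by ring, by ring, by norm_num, by module, ?_⟩
  trans (a * (h0 κ * (1 - cww κ ^ 2) + 3 / 4 * cww κ ^ 2)) • cosMode 0 +
    (a * (h2 κ * (cww (2 * κ) ^ 2 - cww κ ^ 2) + 3 / 4 * cww κ ^ 2)) • cosMode 2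
  · module
  · rw [H0, H2]; simp

theorem tendsto_withκ (κ : ℝ) : Tendsto (withκ κ) (𝓝 0) (𝓝 (0, κ, 0, 0)) := by
  have : Continuous (withκ κ) := by unfold withκ; fun_prop
  exact this.tendsto' 0 _ rfl

theorem firstOrder_isBigO (κ : ℝ) : firstOrder κ =O[𝓝 0] fun v => ‖v‖ := by
  have h : DifferentiableAt ℝ (firstOrder κ) 0 := by unfold firstOrder; fun_prop
  have h0 : firstOrder κ 0 = 0 := by simp [firstOrder]
  have := h.isBigO_sub
  simp only [h0, sub_zero] at this
  exact this.norm_right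

/-- `firstOrder` cancels the linear part of `sys`, so its residual is `quadPart`. -/
theorem branch_firstOrder {κ : ℝ} (hκ : 0 < κ) {φ : Param → Unknown}
    (hφ : Tendsto φ (𝓝 (0, κ, 0, 0)) (𝓝 0))
    (hsol : ∀ᶠ p in 𝓝 ((0, κ, 0, 0) : Param), sys (p, φ p) = 0) :
    (fun v => φ (withκ κ v) - firstOrder κ v) =O[𝓝 0] fun v => ‖v‖ ^ 2 := by
  obtain ⟨C, hC⟩ := exists_residual_bound (analyticAt_sys (q := ((0, κ, 0, 0), 0)) hκ)
    (hasFDerivAt_sys_equiv hκ) hφ hsol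
  have hO := firstOrder_isBigO κ
  have ht0 : Tendsto (firstOrder κ) (𝓝 0) (𝓝 0) :=
    hO.trans_tendsto tendsto_norm_zero
  have hpair : Tendsto (fun v => (withκ κ v, firstOrder κ v)) (𝓝 0) (𝓝 ((0, κ, 0, 0), 0)) := by
    have := (tendsto_withκ κ).prodMk ht0
    rwa [← nhds_prod_eq] at this
  have hpair2 : Tendsto (fun v : ℝ × ℝ × ℝ => (v, firstOrder κ v)) (𝓝 0) (𝓝 0) := by
    have := (tendsto_id (x := 𝓝 (0 : ℝ × ℝ × ℝ))).prodMk ht0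
    rwa [← nhds_prod_eq] at this
  have h1 : (fun v => φ (withκ κ v) - firstOrder κ v) =O[𝓝 0]
      fun v => sys (withκ κ v, firstOrder κ v) := by
    refine IsBigO.of_bound C ?_
    filter_upwards [hpair.eventually hC] with v hv
    rw [norm_sub_rev]
    exact hv
  have h2 : (fun v => sys (withκ κ v, firstOrder κ v)) =O[𝓝 0]
      fun v => ‖(v, firstOrder κ v)‖ ^ 2 := by
    refine ((quadPart_isBigO κ).comp_tendsto hpair2).congr_left fun v => ?_
    rw [sys_decomp, linOp_firstOrder hκ, zero_add]
    rfl
  refine (h1.trans h2).trans (IsBigO.pow ?_ 2)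
  have h3 : (fun v : ℝ × ℝ × ℝ => v) =O[𝓝 0] fun v => ‖v‖ := (isBigO_refl _ _).norm_right
  exact (h3.prod_left hO).norm_left

/-! ### The speed to second order in the amplitude -/

/-- For `b₁ = b₂ = 0` the constants `m`, `w` vanish. -/
theorem constants_eq_zero {κ : ℝ} (hκ : 0 < κ) : ∀ᶠ x : Unknown in 𝓝 0, ∀ a : ℝ,
    sys ((a, κ, 0, 0), x) = 0 → x.1 = 0 ∧ x.2.1 = 0 := by
  have hc1 := cww_sq_lt_one hκ
  have hcont : Continuous (fun x : Unknown =>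
      1 + x.1 - (cww κ + x.2.2.1) ^ 2 + (cww κ + x.2.2.1) * x.2.1 / 2) := by fun_prop
  have hne : ∀ᶠ x : Unknown in 𝓝 0,
      1 + x.1 - (cww κ + x.2.2.1) ^ 2 + (cww κ + x.2.2.1) * x.2.1 / 2 ≠ 0 := by
    refine hcont.continuousAt.eventually_ne ?_
    simp only [Prod.fst_zero, Prod.snd_zero]
    linarith
  filter_upwards [hne] with x hx a hs
  simp only [sys, sysFun, Prod.mk_eq_zero] at hs
  obtain ⟨e1, e2, -⟩ := hs
  have hw : x.2.1 = 0 := by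
    refine (mul_eq_zero.1 (?_ : x.2.1 * (1 + x.1 - (cww κ + x.2.2.1) ^ 2 +
      (cww κ + x.2.2.1) * x.2.1 / 2) = 0)).resolve_right hx
    linear_combination e1 + (cww κ + x.2.2.1) * e2
  refine ⟨?_, hw⟩
  rw [hw] at e2
  linear_combination e2

/-- For `b₁ = b₂ = 0` the speed is `cww κ + 3/4 cww κ (2 h₀ + h₂ - 1) a² + O(a³)`. -/
theorem speed_second_order {κ : ℝ} (hκ : 0 < κ) {φ : Param → Unknown}
    (hφ : Tendsto φ (𝓝 (0, κ, 0, 0)) (𝓝 0))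
    (hsol : ∀ᶠ p in 𝓝 ((0, κ, 0, 0) : Param), sys (p, φ p) = 0) :
    (fun a : ℝ => (φ (a, κ, 0, 0)).2.2.1 - 3 / 4 * cww κ * (2 * h0 κ + h2 κ - 1) * a ^ 2) =O[𝓝 0]
      fun a => a ^ 3 := by
  have hc := cww_pos hκ
  set l : Filter ℝ := 𝓝 0 with hl
  have hv : Tendsto (fun a : ℝ => ((a, 0, 0) : ℝ × ℝ × ℝ)) l (𝓝 0) := by
    have : Continuous (fun a : ℝ => ((a, 0, 0) : ℝ × ℝ × ℝ)) := by fun_prop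
    exact this.tendsto' 0 0 rfl
  have hp : Tendsto (fun a : ℝ => ((a, κ, 0, 0) : Param)) l (𝓝 (0, κ, 0, 0)) :=
    (tendsto_withκ κ).comp hv
  have hfo : (fun a : ℝ => φ (a, κ, 0, 0) - firstOrder κ (a, 0, 0)) =O[l] fun a => a ^ 2 := by
    refine ((branch_firstOrder hκ hφ hsol).comp_tendsto hv).congr' (EventuallyEq.refl _ _)
      (Eventually.of_forall fun a => ?_)
    simp [Prod.norm_def]
  set g : ℝ → ℝ := fun a => (φ (a, κ, 0, 0)).2.2.1 with hg
  set α : ℝ → Coeff := fun a => (φ (a, κ, 0, 0)).2.2.2.1 with hα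
  set β : ℝ → Coeff := fun a => (φ (a, κ, 0, 0)).2.2.2.2 with hβ
  set α₁ : Coeff := h0 κ • cosMode 0 + h2 κ • cosMode 2 with hα₁
  set β₁ : Coeff := cww κ • ((h0 κ - 1 / 2) • cosMode 0 + (h2 κ - 1 / 2) • cosMode 2) with hβ₁
  have hgO : g =O[l] fun a => a ^ 2 := by
    refine hfo.prod_left_snd.prod_left_snd.prod_left_fst.congr_left fun a => ?_
    simp [firstOrder, hg]
  have hαO : (fun a => α a - a • α₁) =O[l] fun a => a ^ 2 := by
    refine hfo.prod_left_snd.prod_left_snd.prod_left_snd.prod_left_fst.congr_left fun a => ?_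
    simp [firstOrder, hα, hα₁]
  have hβO : (fun a => β a - a • β₁) =O[l] fun a => a ^ 2 := by
    refine hfo.prod_left_snd.prod_left_snd.prod_left_snd.prod_left_snd.congr_left fun a => ?_
    simp [firstOrder, hβ, hβ₁, smul_smul, mul_assoc]
  have h21 : (fun a : ℝ => a ^ 2) =O[l] fun a => a := by
    simpa using (isLittleO_pow_pow (𝕜 := ℝ) (m := 1) (n := 2) (by norm_num)).isBigO
  have hid : (fun a : ℝ => a) =O[l] fun a => a := isBigO_refl _ _
  have hα1 : α =O[l] fun a => a := by
    have h := (hαO.trans h21).add (f₂ := fun a : ℝ => a • α₁)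
      ((hid.smul (isBigO_refl (fun _ : ℝ => α₁) l)).trans (IsBigO.of_bound ‖α₁‖
        (Eventually.of_forall fun a => by simp [norm_smul, mul_comm])))
    exact h.congr_left fun a => by abel
  have hβ1 : β =O[l] fun a => a := by
    have h := (hβO.trans h21).add (f₂ := fun a : ℝ => a • β₁)
      ((hid.smul (isBigO_refl (fun _ : ℝ => β₁) l)).trans (IsBigO.of_bound ‖β₁‖
        (Eventually.of_forall fun a => by simp [norm_smul, mul_comm])))
    exact h.congr_left fun a => by abel
  have hbil : ∀ {x y : ℝ → Coeff}, x =O[l] (fun a => a) → y =O[l] (fun a => a) →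
      (fun a => coord 1 (mul (x a) (y a))) =O[l] fun a => a ^ 2 := by
    intro x y hx hy
    have : (fun a => mul (x a) (y a)) =O[l] fun a => ‖x a‖ * ‖y a‖ :=
      IsBigO.of_bound ‖mul‖ (Eventually.of_forall fun a => by
        simpa [mul_assoc] using mul.le_opNorm₂ (x a) (y a))
    exact (((coord 1).isBigO_comp _ _).trans
      (this.trans (hx.norm_left.mul hy.norm_left))).congr_right fun a => (sq a).symm
  -- `M` and `V` are the first Fourier coefficients of `ũ η̃` and `ũ ũ`, where `η̃ = cos z + α` and
  -- `ũ = cww κ cos z + β`.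
  set M : ℝ → ℝ := fun a => coord 1 (mul (cww κ • cosMode 1 + β a) (cosMode 1 + α a)) with hM
  set V : ℝ → ℝ := fun a =>
    coord 1 (mul (cww κ • cosMode 1 + β a) (cww κ • cosMode 1 + β a)) with hV
  have c11 : coord 1 (mul (cosMode 1) (cosMode 1)) = 0 := by
    simp [mul_cosMode_one_one, coord_cosMode]
  have hlin : ∀ s t : ℝ, coord 1 (mul (cosMode 1) (s • cosMode 0 + t • cosMode 2)) = 2 * s + t := by
    intro s t
    have e0 : mul (cosMode 1) (cosMode 0) = (1 / 2 : ℝ) • cosMode 1 + (1 / 2 : ℝ) • cosMode 1 :=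
      mul_cosMode 1 0
    have e2 : mul (cosMode 1) (cosMode 2) = (1 / 2 : ℝ) • cosMode 3 + (1 / 2 : ℝ) • cosMode 1 :=
      mul_cosMode 1 2
    simp [e0, e2, coord_cosMode]
    ring
  have hLO : ∀ {x : ℝ → Coeff} {x₁ : Coeff}, (fun a => x a - a • x₁) =O[l] (fun a => a ^ 2) →
      (fun a => coord 1 (mul (cosMode 1) (x a)) - a * coord 1 (mul (cosMode 1) x₁)) =O[l]
        fun a => a ^ 2 := by
    intro x x₁ hx
    refine ((((coord 1).comp (mul (cosMode 1))).isBigO_comp _ _).trans hx).congr_left fun a => ?_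
    simp
  have hMO : (fun a => M a - a * (cww κ * (4 * h0 κ + 2 * h2 κ - 3 / 2))) =O[l] fun a => a ^ 2 := by
    refine ((((hLO hαO).const_mul_left (cww κ)).add (hLO hβO)).add (hbil hβ1 hα1)).congr_left
      fun a => ?_
    simp only [hM, map_add, map_smul, _root_.add_apply, _root_.smul_apply, c11,
      mul_comm' (β a) (cosMode 1), hα₁, hβ₁, smul_eq_mul]
    have hlinβ := hlin (h0 κ - 1 / 2) (h2 κ - 1 / 2)
    simp only [map_add, map_smul, smul_eq_mul] at hlinβ
    have hlinα := hlin (h0 κ) (h2 κ)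
    simp only [map_add, map_smul, smul_eq_mul] at hlinα
    rw [hlinβ, hlinα]
    ring
  have hVO : (fun a => V a - a * (cww κ ^ 2 * (4 * h0 κ + 2 * h2 κ - 3))) =O[l] fun a => a ^ 2 := by
    refine (((hLO hβO).const_mul_left (2 * cww κ)).add (hbil hβ1 hβ1)).congr_left fun a => ?_
    simp only [hV, map_add, map_smul, _root_.add_apply, _root_.smul_apply, c11,
      mul_comm' (β a) (cosMode 1), hβ₁, smul_eq_mul]
    have hlinβ := hlin (h0 κ - 1 / 2) (h2 κ - 1 / 2)
    simp only [map_add, map_smul, smul_eq_mul] at hlinβ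
    rw [hlinβ]
    ring
  -- Elimination of the first Fourier coefficient of `ũ` leaves a scalar equation for `g`.
  have key : ∀ᶠ a in l, 4 * (2 * cww κ * g a + g a ^ 2) =
      a * (2 * (cww κ + g a) * M a + V a) := by
    filter_upwards [hp.eventually hsol,
      (hφ.comp hp).eventually (constants_eq_zero hκ)] with a h1 h2
    obtain ⟨hm, hw⟩ := h2 a h1
    simp only [sys, sysFun, Prod.mk_eq_zero] at h1
    obtain ⟨-, -, e3, e4, e5⟩ := h1
    simp only [Function.comp_apply] at hm hw
    rw [hm, hw] at e4
    rw [hw] at e5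
    have k4 := congrArg (coord 1) e4
    have k5 := congrArg (coord 1) e5
    have hα0 : coord 1 (α a) = 0 := by simpa using e3
    rw [map_add, map_add, map_smul, map_smul, map_smul, map_zero, map_add, map_add, map_smul,
      coord_cosMode] at k4
    rw [map_add, map_add, map_smul, map_smul, coord_dispOp, map_zero, map_add, map_add, map_smul,
      coord_cosMode] at k5
    change (0 - (cww κ + g a)) • (_ + coord 1 (α a)) + (1 + 0 : ℝ) • (_ + coord 1 (β a)) +
      a • M a = 0 at k4
    change (0 - (cww κ + g a)) • (_ + coord 1 (β a)) + _ * (_ + coord 1 (α a)) +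
      (a / 2) • V a = 0 at k5
    simp only [hα0, smul_eq_mul, Nat.cast_one, one_mul, if_true, pow_one] at k4 k5
    linear_combination -2 * k5 - 2 * (cww κ + g a) * k4
  have hg2 : (fun a => g a ^ 2) =O[l] fun a => a ^ 3 := by
    have h1 : (fun a : ℝ => a ^ 2 * a ^ 2) =O[l] fun a => a ^ 3 := by
      have := (isLittleO_pow_pow (𝕜 := ℝ) (m := 3) (n := 4) (by norm_num)).isBigO
      exact this.congr_left fun a => by ring
    exact ((hgO.mul hgO).trans h1).congr_left fun a => (sq _).symm
  have hM1 : M =O[l] fun a => a := by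
    have := (hMO.trans h21).add (f₂ := fun a => a * (cww κ * (4 * h0 κ + 2 * h2 κ - 3 / 2)))
      ((hid.const_mul_left (cww κ * (4 * h0 κ + 2 * h2 κ - 3 / 2))).congr_left fun a => mul_comm _ _)
    exact this.congr_left fun a => by ring
  have hgM : (fun a => a * (2 * g a * M a)) =O[l] fun a => a ^ 3 := by
    have h1 : (fun a : ℝ => a * (a ^ 2 * a)) =O[l] fun a => a ^ 3 := by
      have := (isLittleO_pow_pow (𝕜 := ℝ) (m := 3) (n := 4) (by norm_num)).isBigO
      exact this.congr_left fun a => by ring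
    exact (hid.mul ((hgO.const_mul_left 2).mul hM1)).trans h1
  have hfin := (((hid.mul hMO).congr_right (g₂ := fun a => a ^ 3) fun a => by ring).const_mul_left
    (2 * cww κ)).add ((hid.mul hVO).congr_right (g₂ := fun a => a ^ 3) fun a => by ring)
  refine (((hfin.add hgM).sub (hg2.const_mul_left 4)).const_mul_left (8 * cww κ)⁻¹).congr'
    ?_ EventuallyEq.rfl
  filter_upwards [key] with a ha
  rw [inv_mul_eq_iff_eq_mul₀ (by positivity)]
  linear_combination -ha

/-! ### The waves -/

/-- The coefficients of `η = m + a (cos z + α)`. -/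
noncomputable def etaCoeff (p : Param) (x : Unknown) : Coeff :=
  x.1 • cosMode 0 + p.1 • (cosMode 1 + x.2.2.2.1)

/-- The coefficients of `u = w + a (cww κ cos z + β)`. -/
noncomputable def uCoeff (p : Param) (x : Unknown) : Coeff :=
  x.2.1 • cosMode 0 + p.1 • (cww p.2.1 • cosMode 1 + x.2.2.2.2)

theorem eval_combination (s t : ℝ) (x y : Coeff) (z : ℝ) :
    eval 0 (s • x + t • y) z = s * eval 0 x z + t * eval 0 y z := by
  have : evalAt 0 z (s • x + t • y) = s * evalAt 0 z x + t * evalAt 0 z y := by simp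
  exact this

theorem solvesSystem_of_sys {a κ b₁ b₂ : ℝ} {x : Unknown} (h : sys ((a, κ, b₁, b₂), x) = 0) :
    SolvesSystem κ b₁ b₂ (cww κ + x.2.2.1) (fun z => eval 0 (etaCoeff (a, κ, b₁, b₂) x) z)
      (fun z => eval 0 (uCoeff (a, κ, b₁, b₂) x) z) := by
  obtain ⟨m, w, g, α, β⟩ := x
  simp only [sys, sysFun, Prod.mk_eq_zero] at h
  obtain ⟨e1, e2, -, e4, e5⟩ := h
  have hdisp : ∀ z, dispersion κ (fun z => eval 0 (etaCoeff (a, κ, b₁, b₂) (m, w, g, α, β)) z) z =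
      _ := fun z => dispersion_eval κ _ z
  have d0 : dispOp κ (cosMode 0) = cosMode 0 := by simp [dispOp_cosMode, cww_zero]
  simp only [SolvesSystem, hdisp]
  simp only [etaCoeff, uCoeff]
  generalize hX : cosMode 1 + α = X at *
  generalize hY : cww κ • cosMode 1 + β = Y at *
  have hz : ∀ z, eval 0 (cosMode 0) z = 1 := fun z => by simp [eval_cosMode]
  have k4 : ∀ z, (w - (cww κ + g)) * eval 0 X z + (1 + m) * eval 0 Y z +
      a * (eval 0 Y z * eval 0 X z) = 0 := fun z => by
    have := congrArg (evalAt 0 z) e4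
    simpa only [map_add, map_smul, map_zero, evalAt_apply, eval_mul, smul_eq_mul] using this
  have k5 : ∀ z, (w - (cww κ + g)) * eval 0 Y z + eval 0 (dispOp κ X) z +
      a / 2 * (eval 0 Y z * eval 0 Y z) = 0 := fun z => by
    have := congrArg (evalAt 0 z) e5
    simpa only [map_add, map_smul, map_zero, evalAt_apply, eval_mul, smul_eq_mul] using this
  refine ⟨fun z => ?_, fun z => ?_⟩
  · simp only [eval_combination, hz]
    linear_combination e1 + a * k4 z
  · have hreal : -(cww κ + g) * eval 0 (w • cosMode 0 + a • Y) z +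
        eval 0 (dispOp κ (m • cosMode 0 + a • X)) z +
        1 / 2 * (eval 0 (w • cosMode 0 + a • Y) z) ^ 2 = (1 - (cww κ + g) ^ 2) * b₂ := by
      simp only [map_add, map_smul, d0]
      have e := eval_combination m a (cosMode 0) (dispOp κ X) z
      simp only [map_add, map_smul] at e
      have e' := eval_combination w a (cosMode 0) Y z
      simp only [map_add, map_smul] at e'
      rw [e, e', hz]
      linear_combination e2 + a * k5 z
    have hC := congrArg (fun t : ℝ => (t : ℂ)) hreal
    push_cast at hC ⊢
    exact hC

attribute [local fun_prop] analyticAt_fst analyticAt_snd in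
theorem analyticAt_cww_param {p : Param} (hκ : 0 < p.2.1) :
    AnalyticAt ℝ (fun p : Param => cww p.2.1) p :=
  (analyticAt_cww hκ).comp (f := fun p : Param => p.2.1) (by fun_prop)

attribute [local fun_prop] analyticAt_fst analyticAt_snd in
theorem analyticAt_waves {φ : Param → Unknown} {p : Param} (hφ : AnalyticAt ℝ φ p)
    (hκ : 0 < p.2.1) : AnalyticAt ℝ (fun p => etaCoeff p (φ p)) p ∧
      AnalyticAt ℝ (fun p => uCoeff p (φ p)) p ∧
      AnalyticAt ℝ (fun p => cww p.2.1 + (φ p).2.2.1) p := by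
  have := analyticAt_cww_param hκ
  unfold etaCoeff uCoeff
  refine ⟨?_, ?_, ?_⟩ <;> fun_prop

theorem analyticFamilyOn_eval {U : Set Param} {X : Param → Coeff} (hX : AnalyticOnNhd ℝ X U) :
    AnalyticFamilyOn (fun p z => eval 0 (X p) z) U := fun k =>
  ⟨fun p => eval k (X p), fun p hp => ((eval k).analyticAt _).comp (hX p hp),
    fun p _ z => (congrFun (iteratedDeriv_eval k (X p)) z).symm⟩

/-! ### Uniform error bounds -/

/-- A quadratic bound in the small parameters, in the form used for the expansions. -/
theorem exists_quadratic_bound {F : Type*} [SeminormedAddCommGroup F] {f : ℝ × ℝ × ℝ → F}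
    (hf : f =O[𝓝 0] fun v => ‖v‖ ^ 2) : ∃ C, 0 ≤ C ∧ ∀ᶠ v : ℝ × ℝ × ℝ in 𝓝 0,
      ‖f v‖ ≤ C * (|v.1| + |v.2.1| + |v.2.2|) ^ 2 := by
  obtain ⟨C, hC0, hC⟩ := hf.exists_nonneg
  refine ⟨C, hC0, hC.bound.mono fun v hv => hv.trans ?_⟩
  rw [norm_pow, norm_norm]
  gcongr
  simp only [Prod.norm_def, Real.norm_eq_abs]
  have h1 := abs_nonneg v.1
  have h2 := abs_nonneg v.2.1
  have h3 := abs_nonneg v.2.2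
  exact max_le (by linarith) (max_le (by linarith) (by linarith))

/-- An analytic function that is even in `a`, whose expansion at `b₁ = b₂ = 0` is known up to
`O(a³)`, has the same `a²` term for all small `b₁`, `b₂`. -/
theorem exists_even_bound {G : ℝ × ℝ × ℝ → ℝ} {γ : ℝ} (hG : AnalyticAt ℝ G 0)
    (he : ∀ᶠ v in 𝓝 (0 : ℝ × ℝ × ℝ), G (-v.1, v.2) = G v) (hG0 : G 0 = 0)
    (h : (fun a : ℝ => G (a, 0, 0) - γ * a ^ 2) =O[𝓝 0] fun a => a ^ 3) :
    ∃ C, 0 ≤ C ∧ ∀ᶠ v : ℝ × ℝ × ℝ in 𝓝 0,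
      |G v - G (0, v.2) - γ * v.1 ^ 2| ≤ C * (|v.1| * (|v.1| + |v.2.1| + |v.2.2|) ^ 2) := by
  obtain ⟨l, hl⟩ := even_taylor hG he
  have hv : Tendsto (fun a : ℝ => ((a, 0, 0) : ℝ × ℝ × ℝ)) (𝓝 0) (𝓝 0) := by
    have : Continuous (fun a : ℝ => ((a, 0, 0) : ℝ × ℝ × ℝ)) := by fun_prop
    exact this.tendsto' 0 0 rfl
  have h1 : (fun a : ℝ => G (a, 0, 0) - l * a ^ 2) =O[𝓝 0] fun a => a ^ 3 := by
    have := hl.comp_tendsto hv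
    refine IsBigO.of_norm_right ?_
    refine this.congr (fun a => ?_) (fun a => ?_)
    · have : G (0, 0, 0) = 0 := hG0
      simp [this]
    · simp only [Function.comp_apply, Prod.norm_def, Real.norm_eq_abs, abs_pow]
      simp only [abs_zero, max_self, abs_nonneg, sup_of_le_left]
      ring
  have h2 : (fun a : ℝ => (l - γ) * a ^ 2) =O[𝓝 0] fun a => a ^ 3 :=
    (h.sub h1).congr_left fun a => by ring
  have hlγ : l = γ := by
    by_contra hne
    have h3 : (fun a : ℝ => a ^ 2) =O[𝓝 0] fun a => a ^ 3 :=
      (h2.const_mul_left (l - γ)⁻¹).congr_left fun a => by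
        rw [inv_mul_cancel_left₀ (sub_ne_zero.2 hne)]
    have h4 : (fun a : ℝ => a ^ 2) =o[𝓝 0] fun a : ℝ => a ^ 2 :=
      h3.trans_isLittleO (isLittleO_pow_pow (𝕜 := ℝ) (m := 2) (n := 3) (by norm_num))
    have h5 := h4.mono (nhdsWithin_le_nhds (s := {0}ᶜ))
    exact (isLittleO_irrefl (l := 𝓝[≠] (0 : ℝ)) (f'' := fun t : ℝ => t ^ 2)
      (Filter.Eventually.frequently (eventually_mem_nhdsWithin.mono fun t ht => pow_ne_zero 2 ht)))
      h5
  subst hlγ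
  obtain ⟨C, hC0, hC⟩ := hl.exists_nonneg
  refine ⟨C, hC0, hC.bound.mono fun v hv => hv.trans ?_⟩
  rw [norm_mul, norm_pow, norm_norm, Real.norm_eq_abs, abs_abs]
  gcongr
  simp only [Prod.norm_def, Real.norm_eq_abs]
  have h1 := abs_nonneg v.1
  have h2 := abs_nonneg v.2.1
  have h3 := abs_nonneg v.2.2
  exact max_le (by linarith) (max_le (by linarith) (by linarith))

theorem eventually_small {q : ℝ × ℝ × ℝ → Prop} (h : ∀ᶠ v in 𝓝 0, q v) :
    ∃ δ : ℝ, 0 < δ ∧ ∀ a b₁ b₂ : ℝ, |a| < δ → |b₁| < δ → |b₂| < δ → q (a, b₁, b₂) := by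
  obtain ⟨δ, hδ, hq⟩ := Metric.eventually_nhds_iff_ball.1 h
  refine ⟨δ, hδ, fun a b₁ b₂ h1 h2 h3 => hq _ ?_⟩
  simp only [mem_ball_zero_iff, Prod.norm_def, Real.norm_eq_abs]
  exact max_lt h1 (max_lt h2 h3)

attribute [local fun_prop] analyticAt_fst analyticAt_snd in
/-- The expansions at a fixed `κ`. -/
theorem branch_expansion {κ : ℝ} (hκ : 0 < κ) {φ : Param → Unknown}
    (hφ0 : φ (0, κ, 0, 0) = 0) (hφa : AnalyticAt ℝ φ (0, κ, 0, 0))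
    (hsol : ∀ᶠ p in 𝓝 ((0, κ, 0, 0) : Param), sys (p, φ p) = 0)
    (hrefl : ∀ᶠ v in 𝓝 (0 : ℝ × ℝ × ℝ), φ (withκ κ (-v.1, v.2)) = reflect (φ (withκ κ v))) :
    ∃ C, 0 ≤ C ∧ ∀ᶠ v in 𝓝 (0 : ℝ × ℝ × ℝ),
      ‖φ (withκ κ v) - firstOrder κ v‖ ≤ C * (|v.1| + |v.2.1| + |v.2.2|) ^ 2 ∧
      |(φ (withκ κ v)).1 - (φ (withκ κ (0, v.2))).1| ≤
        C * (|v.1| * (|v.1| + |v.2.1| + |v.2.2|) ^ 2) ∧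
      |(φ (withκ κ v)).2.1 - (φ (withκ κ (0, v.2))).2.1| ≤
        C * (|v.1| * (|v.1| + |v.2.1| + |v.2.2|) ^ 2) ∧
      |(φ (withκ κ v)).2.2.1 - (φ (withκ κ (0, v.2))).2.2.1 -
          3 / 4 * cww κ * (2 * h0 κ + h2 κ - 1) * v.1 ^ 2| ≤
        C * (|v.1| * (|v.1| + |v.2.1| + |v.2.2|) ^ 2) := by
  have hφt : Tendsto φ (𝓝 (0, κ, 0, 0)) (𝓝 0) := by
    have := hφa.continuousAt.tendsto
    rwa [hφ0] at this
  have hψa : AnalyticAt ℝ (fun v => φ (withκ κ v)) 0 := by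
    refine hφa.comp_of_eq (f := withκ κ) ?_ rfl
    unfold withκ
    fun_prop
  have hm : AnalyticAt ℝ (fun v => (φ (withκ κ v)).1) 0 :=
    analyticAt_fst.comp (f := fun v => φ (withκ κ v)) hψa
  have hw : AnalyticAt ℝ (fun v => (φ (withκ κ v)).2) 0 :=
    analyticAt_snd.comp (f := fun v => φ (withκ κ v)) hψa
  have hg : AnalyticAt ℝ (fun v => (φ (withκ κ v)).2.2) 0 :=
    analyticAt_snd.comp (f := fun v => (φ (withκ κ v)).2) hw
  have hψ0 : φ (withκ κ 0) = 0 := hφ0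
  have hp : Tendsto (fun a : ℝ => ((a, κ, 0, 0) : Param)) (𝓝 0) (𝓝 (0, κ, 0, 0)) := by
    have : Continuous (fun a : ℝ => ((a, κ, 0, 0) : Param)) := by fun_prop
    exact this.tendsto' 0 _ rfl
  have hzero : ∀ᶠ a : ℝ in 𝓝 0, (φ (a, κ, 0, 0)).1 = 0 ∧ (φ (a, κ, 0, 0)).2.1 = 0 := by
    filter_upwards [hp.eventually hsol,
      (hφt.comp hp).eventually (constants_eq_zero hκ)] with a h1 h2
    exact h2 a h1
  obtain ⟨C₁, hC₁, h₁⟩ := exists_quadratic_bound (branch_firstOrder hκ hφt hsol)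
  obtain ⟨C₂, hC₂, h₂⟩ := exists_even_bound (G := fun v => (φ (withκ κ v)).1) (γ := 0)
    hm (hrefl.mono fun v hv => by simp [hv, reflect]) (by simp [hψ0])
    ((isBigO_zero (fun a : ℝ => a ^ 3) (𝓝 0)).congr' (hzero.mono fun a ha => by
      simpa [withκ] using ha.1.symm) EventuallyEq.rfl)
  obtain ⟨C₃, hC₃, h₃⟩ := exists_even_bound (G := fun v => (φ (withκ κ v)).2.1) (γ := 0)
    (analyticAt_fst.comp (f := fun v => (φ (withκ κ v)).2) hw) (hrefl.mono fun v hv => by simp [hv, reflect]) (by simp [hψ0])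
    ((isBigO_zero (fun a : ℝ => a ^ 3) (𝓝 0)).congr' (hzero.mono fun a ha => by
      simpa [withκ] using ha.2.symm) EventuallyEq.rfl)
  obtain ⟨C₄, hC₄, h₄⟩ := exists_even_bound (G := fun v => (φ (withκ κ v)).2.2.1)
    (analyticAt_fst.comp (f := fun v => (φ (withκ κ v)).2.2) hg) (hrefl.mono fun v hv => by simp [hv, reflect]) (by simp [hψ0])
    (speed_second_order hκ hφt hsol)
  refine ⟨C₁ + C₂ + C₃ + C₄, by positivity, ?_⟩
  filter_upwards [h₁, h₂, h₃, h₄] with v k₁ k₂ k₃ k₄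
  simp only [zero_mul, sub_zero] at k₂ k₃
  refine ⟨k₁.trans ?_, k₂.trans ?_, k₃.trans ?_, k₄.trans ?_⟩ <;>
    exact mul_le_mul_of_nonneg_right (by linarith) (by positivity)

theorem abs_eval_le (x : Coeff) (z : ℝ) : |eval 0 x z| ≤ ‖eval 0‖ * ‖x‖ :=
  ((eval 0 x).norm_coe_le_norm z).trans ((eval 0).le_opNorm x)

/-- Pointwise error of `s + a (y + x)`, `y` explicit, when `s` and `x` are known up to errors. -/
theorem abs_wave_sub_le {s s₀ a y N C : ℝ} {x x₁ : Coeff} {z : ℝ}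
    (hs : |s - s₀| ≤ C * (|a| * N)) (hx : ‖x - x₁‖ ≤ C * N) :
    |s + a * (y + eval 0 x z) - (s₀ + a * (y + eval 0 x₁ z))| ≤
      (C + ‖eval 0‖ * C) * (|a| * N) := by
  have h1 := abs_eval_le (x - x₁) z
  have h2 : eval 0 (x - x₁) z = eval 0 x z - eval 0 x₁ z := by
    have := map_sub (evalAt 0 z) x x₁
    exact this
  rw [h2] at h1
  have h3 : |eval 0 x z - eval 0 x₁ z| ≤ ‖eval 0‖ * (C * N) := h1.trans (by gcongr)
  calc _ = |(s - s₀) + a * (eval 0 x z - eval 0 x₁ z)| := by congr 1; ring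
    _ ≤ |s - s₀| + |a| * |eval 0 x z - eval 0 x₁ z| := by
      rw [← abs_mul]; exact abs_add_le _ _
    _ ≤ C * (|a| * N) + |a| * (‖eval 0‖ * (C * N)) := by gcongr
    _ = _ := by ring

end WaveTrain

open WaveTrain Filter Topology Asymptotics in
theorem theorem2p1 :
    -- `U` is the set of admissible parameters `(a, κ, b₁, b₂)`
    ∃ (U : Set (ℝ × ℝ × ℝ × ℝ))
      (η u : ℝ × ℝ × ℝ × ℝ → ℝ → ℝ) (c : ℝ × ℝ × ℝ × ℝ → ℝ)
      (η₀ u₀ c₀ : ℝ → ℝ → ℝ → ℝ),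
      IsOpen U ∧
      (∀ κ : ℝ, 0 < κ → ((0, κ, 0, 0) : ℝ × ℝ × ℝ × ℝ) ∈ U) ∧
      (∀ a κ b₁ b₂ : ℝ, (a, κ, b₁, b₂) ∈ U → 0 < κ ∧ (-a, κ, b₁, b₂) ∈ U) ∧
      -- solutions that are periodic, even and smooth in `z`, with speed even in `a`
      (∀ a κ b₁ b₂ : ℝ, (a, κ, b₁, b₂) ∈ U →
        0 < c (a, κ, b₁, b₂) ∧
        WaveTrain.SolvesSystem κ b₁ b₂ (c (a, κ, b₁, b₂))
          (η (a, κ, b₁, b₂)) (u (a, κ, b₁, b₂)) ∧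
        Function.Periodic (η (a, κ, b₁, b₂)) (2 * Real.pi) ∧
        Function.Periodic (u (a, κ, b₁, b₂)) (2 * Real.pi) ∧
        Function.Even (η (a, κ, b₁, b₂)) ∧
        Function.Even (u (a, κ, b₁, b₂)) ∧
        ContDiff ℝ ((⊤ : ℕ∞) : WithTop ℕ∞) (η (a, κ, b₁, b₂)) ∧
        ContDiff ℝ ((⊤ : ℕ∞) : WithTop ℕ∞) (u (a, κ, b₁, b₂)) ∧
        c (-a, κ, b₁, b₂) = c (a, κ, b₁, b₂)) ∧
      -- joint analytic dependence on the parameters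
      WaveTrain.AnalyticFamilyOn η U ∧
      WaveTrain.AnalyticFamilyOn u U ∧
      AnalyticOnNhd ℝ c U ∧
      -- small-amplitude expansions as `a, b₁, b₂ → 0`, uniformly in `z`
      (∀ κ : ℝ, 0 < κ → ∃ C δ : ℝ, 0 < δ ∧ ∀ a b₁ b₂ : ℝ, |a| < δ → |b₁| < δ → |b₂| < δ →
        (a, κ, b₁, b₂) ∈ U ∧
        (∀ z : ℝ,
          |η (a, κ, b₁, b₂) z -
            (η₀ κ b₁ b₂ + a * Real.cos z
              + a * (b₁ * WaveTrain.cww κ + b₂) * Real.cos z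
              + a ^ 2 * (WaveTrain.h0 κ + WaveTrain.h2 κ * Real.cos (2 * z)))|
            ≤ C * (|a| * (|a| + |b₁| + |b₂|) ^ 2)) ∧
        (∀ z : ℝ,
          |u (a, κ, b₁, b₂) z -
            (u₀ κ b₁ b₂ + a * WaveTrain.cww κ * Real.cos z
              + 1 / 2 * a * WaveTrain.cww κ * (b₁ * WaveTrain.cww κ + b₂) * Real.cos z
              + a ^ 2 * WaveTrain.cww κ *
                (WaveTrain.h0 κ - 1 / 2 + (WaveTrain.h2 κ - 1 / 2) * Real.cos (2 * z)))|
            ≤ C * (|a| * (|a| + |b₁| + |b₂|) ^ 2)) ∧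
        |c (a, κ, b₁, b₂) -
            (c₀ κ b₁ b₂
              + 3 / 4 * a ^ 2 * WaveTrain.cww κ * (2 * WaveTrain.h0 κ + WaveTrain.h2 κ - 1))|
            ≤ C * (|a| * (|a| + |b₁| + |b₂|) ^ 2)) ∧
      -- expansions of the zero-amplitude parts as `b₁, b₂ → 0`
      (∀ κ : ℝ, 0 < κ → ∃ C δ : ℝ, 0 < δ ∧ ∀ b₁ b₂ : ℝ, |b₁| < δ → |b₂| < δ →
        |η₀ κ b₁ b₂ - (b₁ * WaveTrain.cww κ + b₂)| ≤ C * (|b₁| + |b₂|) ^ 2 ∧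
        |u₀ κ b₁ b₂ - (b₁ + b₂ * WaveTrain.cww κ)| ≤ C * (|b₁| + |b₂|) ^ 2 ∧
        |c₀ κ b₁ b₂ -
            (WaveTrain.cww κ + b₁ * (1 / 2 * WaveTrain.cww κ ^ 2 + 1)
              + 3 / 2 * b₂ * WaveTrain.cww κ)| ≤ C * (|b₁| + |b₂|) ^ 2) := by
  obtain ⟨U, φ, hUo, hbase, hφa, hφ⟩ := exists_branch
  have hexp : ∀ κ : ℝ, 0 < κ → _ := fun κ hκ =>
    branch_expansion hκ (hbase κ hκ).2 (hφa _ (hbase κ hκ).1)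
      ((hUo.eventually_mem (hbase κ hκ).1).mono fun p hp => (hφ _ _ _ _ hp).2.2.1)
      (((tendsto_withκ κ).eventually (hUo.eventually_mem (hbase κ hκ).1)).mono
        fun v hv => (hφ _ _ _ _ hv).2.2.2.2)
  refine ⟨U, fun p z => eval 0 (etaCoeff p (φ p)) z, fun p z => eval 0 (uCoeff p (φ p)) z,
    fun p => cww p.2.1 + (φ p).2.2.1, fun κ b₁ b₂ => (φ (0, κ, b₁, b₂)).1,
    fun κ b₁ b₂ => (φ (0, κ, b₁, b₂)).2.1, fun κ b₁ b₂ => cww κ + (φ (0, κ, b₁, b₂)).2.2.1,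
    hUo, fun κ hκ => (hbase κ hκ).1, fun a κ b₁ b₂ hp => ?_, fun a κ b₁ b₂ hp => ?_,
    analyticFamilyOn_eval fun p hp => (analyticAt_waves (hφa p hp) (hφ _ _ _ _ hp).1).1,
    analyticFamilyOn_eval fun p hp => (analyticAt_waves (hφa p hp) (hφ _ _ _ _ hp).1).2.1,
    fun p hp => (analyticAt_waves (hφa p hp) (hφ _ _ _ _ hp).1).2.2,
    fun κ hκ => ?_, fun κ hκ => ?_⟩
  · exact ⟨(hφ a κ b₁ b₂ hp).1, (hφ a κ b₁ b₂ hp).2.1⟩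
  · obtain ⟨-, -, hs, hc, hr⟩ := hφ a κ b₁ b₂ hp
    refine ⟨hc, solvesSystem_of_sys hs, periodic_eval _, periodic_eval _, even_eval _, even_eval _,
      contDiff_eval _, contDiff_eval _, ?_⟩
    simp only [hr, reflect]
  · obtain ⟨C, hC, h⟩ := hexp κ hκ
    obtain ⟨δ, hδ, hball⟩ := eventually_small
      (h.and ((tendsto_withκ κ).eventually (hUo.eventually_mem (hbase κ hκ).1)))
    refine ⟨C + ‖eval 0‖ * C, δ, hδ, fun a b₁ b₂ ha hb₁ hb₂ => ?_⟩
    obtain ⟨⟨k1, k2, k3, k4⟩, hU⟩ := hball a b₁ b₂ ha hb₁ hb₂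
    simp only [withκ] at k1 k2 k3 k4 hU
    set x := φ (a, κ, b₁, b₂) with hx
    have kα : ‖x.2.2.2.1 - (firstOrder κ (a, b₁, b₂)).2.2.2.1‖ ≤ C * (|a| + |b₁| + |b₂|) ^ 2 :=
      (((norm_fst_le _).trans (norm_snd_le _)).trans ((norm_snd_le _).trans
        (norm_snd_le (x - firstOrder κ (a, b₁, b₂))))).trans k1
    have kβ : ‖x.2.2.2.2 - (firstOrder κ (a, b₁, b₂)).2.2.2.2‖ ≤ C * (|a| + |b₁| + |b₂|) ^ 2 :=
      (((norm_snd_le _).trans (norm_snd_le _)).trans ((norm_snd_le _).trans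
        (norm_snd_le (x - firstOrder κ (a, b₁, b₂))))).trans k1
    have z0 : ∀ z, eval 0 (cosMode 0) z = 1 := fun z => by simp [eval_cosMode]
    have z1 : ∀ z, eval 0 (cosMode 1) z = Real.cos z := fun z => by simp [eval_cosMode]
    have z2 : ∀ z, eval 0 (cosMode 2) z = Real.cos (2 * z) := fun z => by simp [eval_cosMode]
    refine ⟨hU, fun z => ?_, fun z => ?_, ?_⟩
    · convert abs_wave_sub_le (y := Real.cos z) (z := z) k2 kα using 2
      have e1 := eval_combination 1 1 (cosMode 1) x.2.2.2.1 z
      simp only [one_smul] at e1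
      simp only [etaCoeff, firstOrder, eval_combination, ← hx, e1, z0, z1, z2]
      ring
    · convert abs_wave_sub_le (y := cww κ * Real.cos z) (z := z) k3 kβ using 2
      have e1 := eval_combination (cww κ) 1 (cosMode 1) x.2.2.2.2 z
      simp only [one_smul] at e1
      simp only [uCoeff, firstOrder, eval_combination, ← hx, e1, z0, z1, z2]
      ring
    · refine le_trans (le_of_eq ?_) (k4.trans
        (mul_le_mul_of_nonneg_right (le_add_of_nonneg_right (by positivity)) (by positivity)))
      congr 1
      ring
  · obtain ⟨C, hC, h⟩ := hexp κ hκ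
    obtain ⟨δ, hδ, hball⟩ := eventually_small h
    refine ⟨C, δ, hδ, fun b₁ b₂ hb₁ hb₂ => ?_⟩
    have k1 := (hball 0 b₁ b₂ (by simpa using hδ) hb₁ hb₂).1
    simp only [withκ, abs_zero, zero_add] at k1
    set x := φ (0, κ, b₁, b₂) with hx
    refine ⟨(norm_fst_le (x - firstOrder κ (0, b₁, b₂))).trans k1,
      ((norm_fst_le _).trans (norm_snd_le (x - firstOrder κ (0, b₁, b₂)))).trans k1, ?_⟩
    have := (((norm_fst_le _).trans (norm_snd_le _)).trans
      (norm_snd_le (x - firstOrder κ (0, b₁, b₂)))).trans k1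
    refine le_trans (le_of_eq ?_) this
    simp only [firstOrder, Prod.snd_sub, Prod.fst_sub, Real.norm_eq_abs]
    congr 1
    ring
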